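/- Let $S=\mathbb{C}[x,y,z]$ and let $C:f=0$ be a reduced curve of degree $d\ge 3$ in $\mathbb{P}^2_{\mathbb C}$, with Jacobian algebra $M(f)=S/(f_x,f_y,f_z)$. Let $d_1\le d_2\le\dots\le d_m$ $(m\ge 2)$ be the degrees of a minimal system of homogeneous generators of the graded $S$-module of syzygies $\{(a,b,c)\in S^3 : af_x+bf_y+cf_z=0\}$, let $$0\to\bigoplus_{j=1}^{m-2}S(-c_j)\to\bigoplus_{i=1}^{m}S(1-d-d_i)\to S^3(1-d)\to S,\qquad c_1\le\dots\le c_{m-2},$$ be the corresponding graded free resolution of $M(f)$ (with $\bigoplus_{j} S(-c_j)\to\bigoplus_i S(1-d-d_i)$ minimal), and define integers $\varepsilon_j$ by $c_j=d+d_{j+2}-1+\varepsilon_j$. The integers $d_i,\varepsilon_j$ are called the graded Betti numbers of $M(f)$. Let $t=d_1+d_2+1-d$ be the type of $C$, let $\tau(C)$ be the total Tjurina number of $C$ (the sum over the singular points $p$ of $C$ of $\dim_{\mathbb C}\mathcal O_{\mathbb P^2,p}/(g,g_u,g_v)$, where $g=0$ is a local equation of $C$ at $p$ and $u,v$ are affine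 coordinates), and put $$E=d_1^2+t\,d_2-\frac{t^2+\sum_{j=1}^{m-2}\varepsilon_j^2}{2}-\sum_{j=1}^{m-2}\varepsilon_j d_{j+2}.$$ (1) One has $\tau(C)-(d-1)(d-d_1-1)=E$ and $E\ge 0$. Moreover $E=0$ if and only if either $m=3$ and $d_2=d_3=d-1$, or $m=2$ and $d_1=0$ (that is, $C$ consists of $d$ concurrent lines). In particular, if $C$ is not free (i.e. $m\ge 3$), then $E>0$ unless $m=3$ and $d_2=d_3=d-1$, in which case $E=0$. (2) The inequality $E\ge 0$ does not follow from the previously known conditions on the graded Betti numbers of a curve that is not free, namely: $m\ge 3$; $1\le d_1\le d_2\le\dots\le d_m$; $\varepsilon_j\ge 1$; $t=\sum_j\varepsilon_j$; $d_{j+2}+\varepsilon_j\le d_{j+3}+\varepsilon_{j+1}$ for $1\le j\le m-3$; $d_3\le d-1$; $d_m\le 2d-4$. Indeed, $d=10$, $(d_1,d_2,d_3,d_4)=(3,8,8,15)$, $(\varepsilon_1,\varepsilon_2)=(1,1)$ satisfy all of these, but give $E=-1$; consequently there is no reduced plane curve of degree at least $3$ with these graded Betti numbers. -/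

import Mathlib

noncomputable section

namespace PlaneCurve

open MvPolynomial

/-- The graded polynomial ring `S = ℂ[x, y, z]`. -/
abbrev S : Type := MvPolynomial (Fin 3) ℂ

/-- `f` is a defining equation of a reduced curve of degree `d` in the complex projective plane. -/
structure IsReducedCurve (f : S) (d : ℕ) : Prop where
  homogeneous : f.IsHomogeneous d
  squarefree : Squarefree f

/-! ### The total Tjurina number -/

/-- The maximal ideal `(u, v)` of the origin in `ℂ[u, v]`. -/
abbrev originIdeal : Ideal (MvPolynomial (Fin 2) ℂ) :=
  RingHom.ker (constantCoeff : MvPolynomial (Fin 2) ℂ →+* ℂ)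

instance originIdeal_isPrime : originIdeal.IsPrime := RingHom.ker_isPrime _

/-- The local ring of the affine plane at the origin. -/
abbrev OriginLocalRing : Type := Localization.AtPrime originIdeal

/-- The Tjurina ideal `(g, ∂g/∂u, ∂g/∂v)` in the local ring of the affine plane at the origin. -/
def tjurinaIdeal (g : MvPolynomial (Fin 2) ℂ) : Ideal OriginLocalRing :=
  Ideal.map (algebraMap (MvPolynomial (Fin 2) ℂ) OriginLocalRing)
    (Ideal.span {g, pderiv 0 g, pderiv 1 g})

/-- The Tjurina number at the origin of the affine plane curve `g = 0`: the complex dimension of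
the local Tjurina algebra `𝒪 / (g, ∂g/∂u, ∂g/∂v)`. It is `0` if the origin is a smooth point of the
curve or does not lie on it. -/
def tjurinaAtOrigin (g : MvPolynomial (Fin 2) ℂ) : ℕ :=
  Module.finrank ℂ (OriginLocalRing ⧸ tjurinaIdeal g)

/-- The equation of the curve `f = 0` in the affine chart where the `i`-th coordinate is nonzero,
in affine coordinates centred at the point with homogeneous coordinates `v` (where `v i ≠ 0`):
the `i`-th variable is set to the constant `v i`, and each other variable `x_j` is replaced by
`v j` plus one of the two affine coordinates. -/
def localEquation (f : S) (v : Fin 3 → ℂ) (i : Fin 3) : MvPolynomial (Fin 2) ℂ :=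
  aeval (Fin.insertNth (α := fun _ => MvPolynomial (Fin 2) ℂ) i (C (v i))
    (fun k => C (v (i.succAbove k)) + X k)) f

/-- A standard affine chart containing the point `p` (for homogeneous `f`, the Tjurina number
at `p` depends neither on this choice nor on the choice of homogeneous coordinates of `p`). -/
def chartIndex (p : Projectivization ℂ (Fin 3 → ℂ)) : Fin 3 :=
  (Function.ne_iff.mp p.rep_nonzero).choose

/-- The Tjurina number of the curve `f = 0` at the point `p` of the projective plane. -/
def tjurinaAt (f : S) (p : Projectivization ℂ (Fin 3 → ℂ)) : ℕ :=
  tjurinaAtOrigin (localEquation f p.rep (chartIndex p))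

/-- The total Tjurina number `τ(C)`: the sum of the Tjurina numbers at all points of the plane; for
a reduced curve the nonzero summands are those at its finitely many singular points. -/
def totalTjurina (f : S) : ℕ := ∑ᶠ p : Projectivization ℂ (Fin 3 → ℂ), tjurinaAt f p

/-! ### Graded Betti numbers of the Jacobian algebra -/

/-- The map `S³ → S` given by the partial derivatives `(f_x, f_y, f_z)`; its cokernel is the
Jacobian algebra `M(f)`. -/
def gradientMap (f : S) : (Fin 3 → S) →ₗ[S] S :=
  Fintype.linearCombination S (fun k => pderiv k f)

/-- A minimal graded free resolution
`0 → ⊕ⱼ S(-cⱼ) → ⊕ᵢ S(1-d-dᵢ) → S³(1-d) → S`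
of the Jacobian algebra of `f` of degree `d`, with `m = n + 2` summands in the middle, where
`d₁ ≤ … ≤ dₘ`, `c₁ ≤ … ≤ cₙ` and `cⱼ = d + d_{j+2} - 1 + εⱼ`. Indices start at `0` in the code:
`δ i` is `d_{i+1}` and `ε j` is `ε_{j+1}`. In the middle, minimality says that the rows
of `gen` are a minimal system of generators of the syzygy module; with this reading
free curves (`n = 0`) are included, also those with `d₁ = 0`, and for `n ≥ 1` and reduced `f`
of degree at least `3` it is equivalent to minimality of the whole complex. -/
structure MinimalResolution (f : S) (d : ℕ) {n : ℕ} (δ : Fin (n + 2) → ℕ) (ε : Fin n → ℤ) where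
  /-- the map `⊕ᵢ S(1-d-dᵢ) → S³(1-d)`, given by homogeneous syzygies of degrees `dᵢ` -/
  gen : Fin (n + 2) → (Fin 3 → S)
  /-- the map `⊕ⱼ S(-cⱼ) → ⊕ᵢ S(1-d-dᵢ)` -/
  rel : Fin n → (Fin (n + 2) → S)
  monotone_gen_degree : Monotone δ
  monotone_rel_degree : Monotone (fun j : Fin n => (δ (j.addNat 2) : ℤ) + ε j)
  gen_homogeneous : ∀ i k, (gen i k).IsHomogeneous (δ i)
  /-- nonzero entries have degree `e = cⱼ - (d - 1 + dᵢ)` -/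
  rel_homogeneous : ∀ j i, rel j i ≠ 0 →
    ∃ e : ℕ, (rel j i).IsHomogeneous e ∧
      (e : ℤ) + (d - 1 + δ i) = d + δ (j.addNat 2) - 1 + ε j
  exact_gen : Submodule.span S (Set.range gen) = LinearMap.ker (gradientMap f)
  exact_rel : Submodule.span S (Set.range rel) =
    LinearMap.ker (Fintype.linearCombination S gen)
  injective_rel : LinearIndependent S rel
  /-- all entries of `rel` lie in the ideal `(x, y, z)` -/
  minimal : ∀ j i, constantCoeff (rel j i) = 0

/-- `(d₁, …, dₘ)` and `(ε₁, …, ε_{m-2})`, with `m = n + 2`, are the graded Betti numbers of the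
Jacobian algebra of the curve `f = 0` of degree `d`. -/
def HasGradedBettiNumbers (f : S) (d : ℕ) {n : ℕ} (δ : Fin (n + 2) → ℕ) (ε : Fin n → ℤ) : Prop :=
  Nonempty (MinimalResolution f d δ ε)

/-- The type `t = d₁ + d₂ + 1 - d`. -/
def curveType (d : ℕ) {n : ℕ} (δ : Fin (n + 2) → ℕ) : ℤ := δ 0 + δ 1 + 1 - d

/-- The expression `E = d₁² + t d₂ - (t² + ∑ⱼ εⱼ²) / 2 - ∑ⱼ εⱼ d_{j+2}`. -/
def bettiE (d : ℕ) {n : ℕ} (δ : Fin (n + 2) → ℕ) (ε : Fin n → ℤ) : ℚ :=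
  (δ 0 : ℚ) ^ 2 + curveType d δ * δ 1
    - ((curveType d δ : ℚ) ^ 2 + ∑ j, (ε j : ℚ) ^ 2) / 2
    - ∑ j, (ε j : ℚ) * δ (j.addNat 2)

/-- The previously known numerical conditions on the graded Betti numbers of a reduced plane curve
of degree `d` that is not free. -/
structure KnownConditions (d : ℕ) {n : ℕ} (δ : Fin (n + 2) → ℕ) (ε : Fin n → ℤ) : Prop where
  degree : 3 ≤ d
  nonfree : 1 ≤ n
  gen_pos : 1 ≤ δ 0
  /-- `d₁ ≤ … ≤ dₘ` -/
  monotone : Monotone δ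
  /-- `εⱼ ≥ 1` -/
  eps_pos : ∀ j, 1 ≤ ε j
  /-- `t = ε₁ + … + ε_{m-2}` -/
  partition : curveType d δ = ∑ j, ε j
  /-- `d_{j+2} + εⱼ ≤ d_{j+3} + ε_{j+1}` -/
  monotone_rel : Monotone (fun j : Fin n => (δ (j.addNat 2) : ℤ) + ε j)
  /-- `d₁ ≤ d₂ ≤ d₃ ≤ d - 1` -/
  first_three : ∀ i : Fin (n + 2), (i : ℕ) ≤ 2 → δ i + 1 ≤ d
  /-- `dₘ ≤ 2d - 4` -/
  last : ∀ i : Fin (n + 2), δ i + 4 ≤ 2 * d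

end PlaneCurve

end

noncomputable section

namespace PlaneCurve

open MvPolynomial Module

/-! ### Graded pieces of free modules over `ℂ[x, y, z]` -/

/-! Put `D = d - 1`, let `F` be the triple of partial derivatives, `J` the ideal they generate and
`AR` their syzygy module. Since `f` is squarefree and the characteristic is zero, the entries of `F`
have no common prime factor. Let `ρ` be the first generator of `AR`, of degree `r = d₁`. A general
constant change of generators turns `F` into a triple `g` with `g₀, g₁` coprime and `g₀, ρ₂`
coprime. Let `N` be the submodule of `AR` generated by `ρ` and the Koszul syzygies `(-g₂, 0, g₀)`,
`(g₁, -g₀, 0)`. These satisfy a single relation, so the Hilbert function of `N` is explicit. A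
syzygy lies in `N` exactly when its last entry lies in `(g₀, ρ₂)`. Hence `AR / N` embeds, up to a
shift, into `S / (g₀, ρ₂)`, which has no nonzero submodule of finite length (`hasKoszulPair`).

The given resolution computes the Hilbert function of `AR`, and the comparison with `N` gives `dim
(AR / N)_k = E` for large `k`. So `E ≥ 0`. If `E = 0`, then `AR / N` has finite length, hence
vanishes: `AR` is generated by `ρ` and two syzygies of degree `D`, and minimality leaves only `m ≤
3` and `d_i = D` for `i ≥ 2` (`MinimalResolution.degrees_of_ker_le_span`). For `m = 2` one has `t =
0` and `E = d₁²`.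

The identity `t = ∑ εⱼ` is not part of the definition of a resolution. It holds because `J` contains
a complete intersection of two forms of degree `D`, so the Hilbert function of `S / J` is bounded by
`D²` and its polynomial (`MinimalResolution.exists_hilb_formula`) has slope zero.

The constant value of that polynomial is `τ(C)` (`exists_hilb_eq_totalTjurina`): one sets a linear
form missing the singular points equal to `1`, splits the resulting finite-dimensional algebra by
the Nullstellensatz and the Chinese remainder theorem, and identifies each factor with a local
Tjurina algebra. The numbers in (2) are excluded because `E = -1` for them. -/

/-- The space of forms of degree `k` in three variables. -/
abbrev Form (k : ℕ) : Submodule ℂ S := homogeneousSubmodule (Fin 3) ℂ k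

instance finite_form (k : ℕ) : Module.Finite ℂ (Form k) :=
  Module.Finite.iff_fg.mpr (homogeneousSubmodule_fg (Fin 3) ℂ k)

theorem finrank_form (k : ℕ) : finrank ℂ (Form k) = (k + 2).choose 2 := by
  have e : Form k ≃ₗ[ℂ] ({d : Fin 3 →₀ ℕ | d.degree = k} →₀ ℂ) :=
    (LinearEquiv.ofEq _ _ (homogeneousSubmodule_eq_finsupp_supported (Fin 3) ℂ k)).trans
      (AddMonoidAlgebra.supportedEquivFinsupp _)
  have hs : {d : Fin 3 →₀ ℕ | d.degree = k}
      = ((Finset.univ : Finset (Fin 3)).finsuppAntidiag k : Set (Fin 3 →₀ ℕ)) := by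
    ext d
    simp [Finsupp.degree_eq_sum]
  rw [hs] at e
  rw [e.finrank_eq, Module.finrank_finsupp_self, ← Nat.card_eq_fintype_card, Nat.card_coe_set_eq,
    Set.ncard_coe_finset, Finset.card_finsuppAntidiag_nat_eq_choose]
  simp only [Finset.card_univ, Fintype.card_fin]
  rw [show 3 + k - 1 = k + 2 by omega, Nat.choose_symm_add]

/-- The dimension of the space of forms of degree `k` in three variables. -/
def formDim (k : ℕ) : ℕ := finrank ℂ (Form k)

theorem two_mul_formDim (k : ℕ) : 2 * (formDim k : ℚ) = (k + 1) * (k + 2) := by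
  rw [formDim, finrank_form, Nat.cast_choose_two]
  push_cast
  ring

theorem two_mul_formDim_sub {k a : ℕ} (h : a ≤ k) :
    2 * (formDim (k - a) : ℚ) = (k - a + 1) * (k - a + 2) := by
  rw [two_mul_formDim, Nat.cast_sub h]

theorem homogeneousComponent_mul_of_isHomogeneous {q g : S} {e n : ℕ} (hg : g.IsHomogeneous e)
    (h : e ≤ n) : homogeneousComponent n (q * g) = homogeneousComponent (n - e) q * g := by
  let _ : GradedAlgebra (homogeneousSubmodule (Fin 3) ℂ) := MvPolynomial.gradedAlgebra
  have := DirectSum.coe_decompose_mul_of_right_mem_of_le (homogeneousSubmodule (Fin 3) ℂ)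
    (a := q) (b := g) (n := n) hg h
  have key : ∀ (p : S) (m : ℕ), (DirectSum.decompose (homogeneousSubmodule (Fin 3) ℂ) p m : S)
    = homogeneousComponent m p := fun p m => decomposition.decompose'_apply p m
  rwa [key, key] at this

variable {κ ι ν : Type*}

/-- The degree `k` part of the graded free module `⊕ₗ S(-β l)`. -/
def gradedPiece (β : ι → ℕ) (k : ℕ) : Submodule ℂ (ι → S) :=
  Submodule.pi Set.univ (fun l => Form (k - β l))

theorem mem_gradedPiece {β : ι → ℕ} {k : ℕ} {v : ι → S} :
    v ∈ gradedPiece β k ↔ ∀ l, (v l).IsHomogeneous (k - β l) := by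
  simp [gradedPiece, Submodule.mem_pi]

/-- The degree `k` part of a graded free module as a product of spaces of forms. -/
def gradedPieceEquiv (β : ι → ℕ) (k : ℕ) : gradedPiece β k ≃ₗ[ℂ] (∀ l, Form (k - β l)) where
  toFun v l := ⟨v.1 l, mem_gradedPiece.mp v.2 l⟩
  invFun w := ⟨fun l => (w l).1, mem_gradedPiece.mpr fun l => (w l).2⟩
  map_add' _ _ := rfl
  map_smul' _ _ := rfl
  left_inv _ := rfl
  right_inv _ := rfl

instance finite_gradedPiece [Finite ι] (β : ι → ℕ) (k : ℕ) :
    Module.Finite ℂ (gradedPiece β k) :=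
  Module.Finite.equiv (gradedPieceEquiv β k).symm

theorem finrank_gradedPiece [Fintype ι] (β : ι → ℕ) (k : ℕ) :
    finrank ℂ (gradedPiece β k) = ∑ l, formDim (k - β l) := by
  rw [(gradedPieceEquiv β k).finrank_eq, Module.finrank_pi_fintype]
  rfl

/-- `G` is the matrix of a graded homomorphism `⊕ᵢ S(-α i) → ⊕ₗ S(-β l)`. -/
def IsGradedMatrix (G : κ → ι → S) (α : κ → ℕ) (β : ι → ℕ) : Prop :=
  ∀ i l, G i l ≠ 0 → ∃ e, (G i l).IsHomogeneous e ∧ e + β l = α i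

theorem homogeneousComponent_mul_graded {q g : S} {a b k : ℕ}
    (hg : g ≠ 0 → ∃ e, g.IsHomogeneous e ∧ e + b = a) (hk : a ≤ k) :
    homogeneousComponent (k - b) (q * g) = homogeneousComponent (k - a) q * g := by
  by_cases h0 : g = 0
  · simp [h0]
  obtain ⟨e, he, hab⟩ := hg h0
  rw [homogeneousComponent_mul_of_isHomogeneous he (by omega), show k - b - e = k - a by omega]

theorem lc_apply [Fintype κ] (G : κ → ι → S) (p : κ → S) (l : ι) :
    Fintype.linearCombination S G p l = ∑ i, p i * G i l := by
  simp [Fintype.linearCombination_apply, Finset.sum_apply]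

/-- The bound `α i ≤ k` matters here and below: `gradedPiece` uses truncated subtraction, so below
degree `α i` it contains constants that do not belong to the true graded piece. -/
theorem IsGradedMatrix.lc_mem [Fintype κ] {G : κ → ι → S} {α : κ → ℕ} {β : ι → ℕ}
    (hG : IsGradedMatrix G α β) {k : ℕ} (hk : ∀ i, α i ≤ k) {p : κ → S}
    (hp : p ∈ gradedPiece α k) : Fintype.linearCombination S G p ∈ gradedPiece β k := by
  rw [mem_gradedPiece] at hp ⊢
  intro l
  rw [lc_apply]
  refine IsHomogeneous.sum _ _ _ fun i _ => ?_
  by_cases h0 : G i l = 0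
  · rw [h0, mul_zero]
    exact isHomogeneous_zero _ _ _
  obtain ⟨e, he, hab⟩ := hG i l h0
  have := (hp i).mul he
  have hki := hk i
  rwa [show k - α i + e = k - β l by omega] at this

/-- Replacing each coefficient by its component of the right degree does not change a homogeneous
image. So the degree `k` part of the image is the image of the degree `k` part. -/
theorem IsGradedMatrix.exists_lift [Fintype κ] {G : κ → ι → S} {α : κ → ℕ} {β : ι → ℕ}
    (hG : IsGradedMatrix G α β) {k : ℕ} (hk : ∀ i, α i ≤ k) {q : κ → S}
    (hq : Fintype.linearCombination S G q ∈ gradedPiece β k) :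
    ∃ p ∈ gradedPiece α k,
      Fintype.linearCombination S G p = Fintype.linearCombination S G q := by
  refine ⟨fun i => homogeneousComponent (k - α i) (q i), ?_, ?_⟩
  · exact mem_gradedPiece.mpr fun i => homogeneousComponent_isHomogeneous _ _
  · ext1 l
    rw [← homogeneousComponent_eq_self (mem_gradedPiece.mp hq l), lc_apply, lc_apply, map_sum]
    exact Finset.sum_congr rfl fun i _ => (homogeneousComponent_mul_graded (hG i l) (hk i)).symm

theorem span_range_eq_range_lc [Fintype κ] {M : Type*} [AddCommGroup M] [Module S M]
    (G : κ → M) :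
    Submodule.span S (Set.range G) = LinearMap.range (Fintype.linearCombination S G) :=
  (Fintype.range_linearCombination S G).symm

/-- Rank-nullity on a finite-dimensional subspace, needed because the ambient polynomial modules are
infinite-dimensional over `ℂ`. -/
theorem finrank_map_add_finrank_inf_ker {V W : Type*} [AddCommGroup V] [Module ℂ V]
    [AddCommGroup W] [Module ℂ W] (T : V →ₗ[ℂ] W) (p : Submodule ℂ V) [FiniteDimensional ℂ p] :
    finrank ℂ (p.map T) + finrank ℂ (p ⊓ LinearMap.ker T : Submodule ℂ V) = finrank ℂ p := by
  have h := (T.domRestrict p).finrank_range_add_finrank_ker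
  rw [LinearMap.range_domRestrict, LinearMap.ker_domRestrict] at h
  have e : finrank ℂ (Submodule.comap p.subtype (LinearMap.ker T))
      = finrank ℂ (p ⊓ LinearMap.ker T : Submodule ℂ V) := by
    rw [← Submodule.map_comap_subtype, Submodule.finrank_map_subtype_eq]
  rw [← e]
  exact h

/-- The degree `k` part of a submodule of a graded free module. -/
abbrev submodulePiece (N : Submodule S (ι → S)) (β : ι → ℕ) (k : ℕ) : Submodule ℂ (ι → S) :=
  gradedPiece β k ⊓ N.restrictScalars ℂ

theorem IsGradedMatrix.finrank_span_add_finrank_ker [Fintype κ] {G : κ → ι → S} {α : κ → ℕ}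
    {β : ι → ℕ} (hG : IsGradedMatrix G α β) {k : ℕ} (hk : ∀ i, α i ≤ k) :
    finrank ℂ (submodulePiece (Submodule.span S (Set.range G)) β k)
      + finrank ℂ (submodulePiece (LinearMap.ker (Fintype.linearCombination S G)) α k)
      = ∑ i, formDim (k - α i) := by
  rw [← finrank_gradedPiece, ← finrank_map_add_finrank_inf_ker
    ((Fintype.linearCombination S G).restrictScalars ℂ) (gradedPiece α k), span_range_eq_range_lc]
  have : submodulePiece (LinearMap.range (Fintype.linearCombination S G)) β k
      = (gradedPiece α k).map ((Fintype.linearCombination S G).restrictScalars ℂ) := by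
    ext v
    constructor
    · rintro ⟨h1, q, rfl⟩
      obtain ⟨p, hp, h⟩ := hG.exists_lift hk h1
      exact ⟨p, hp, h⟩
    · rintro ⟨p, hp, rfl⟩
      exact ⟨hG.lc_mem hk hp, p, rfl⟩
  rw [this]
  rfl

/-- The Hilbert function of a module with a graded free resolution of length one. -/
theorem finrank_span_of_resolution [Fintype κ] [Fintype ν] {G : κ → ι → S}
    {R : ν → κ → S} {α : κ → ℕ} {β : ι → ℕ} {γ : ν → ℕ} (hG : IsGradedMatrix G α β)
    (hR : IsGradedMatrix R γ α)
    (hGR : Submodule.span S (Set.range R) = LinearMap.ker (Fintype.linearCombination S G))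
    (hinj : LinearIndependent S R) {k : ℕ} (hα : ∀ i, α i ≤ k) (hγ : ∀ j, γ j ≤ k) :
    finrank ℂ (submodulePiece (Submodule.span S (Set.range G)) β k)
      + ∑ j, formDim (k - γ j) = ∑ i, formDim (k - α i) := by
  rw [← hG.finrank_span_add_finrank_ker hα, ← hR.finrank_span_add_finrank_ker hγ, hGR]
  have : LinearMap.ker (Fintype.linearCombination S R) = ⊥ := by
    rw [LinearMap.ker_eq_bot]
    exact linearIndependent_iff_injective_fintypeLinearCombination.mp hinj
  have h0 : submodulePiece (LinearMap.ker (Fintype.linearCombination S R)) γ k = ⊥ := by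
    rw [this]; simp [submodulePiece]
  rw [h0, finrank_bot, add_zero]

/-! ### Hilbert functions -/

/-- The Hilbert function of `S / I` for a homogeneous ideal `I`. -/
def hilb (I : Ideal S) (k : ℕ) : ℕ :=
  finrank ℂ ((Form k).map (Ideal.Quotient.mkₐ ℂ I).toLinearMap)

theorem hilb_add_finrank_inf (I : Ideal S) (k : ℕ) :
    hilb I k + finrank ℂ (Form k ⊓ I.restrictScalars ℂ : Submodule ℂ S) = formDim k := by
  rw [formDim, ← finrank_map_add_finrank_inf_ker (Ideal.Quotient.mkₐ ℂ I).toLinearMap (Form k), hilb]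
  have : LinearMap.ker (Ideal.Quotient.mkₐ ℂ I).toLinearMap = I.restrictScalars ℂ := by
    ext x
    simp [Ideal.Quotient.eq_zero_iff_mem]
  rw [this]

theorem hilb_anti {I J : Ideal S} (h : I ≤ J) (k : ℕ) : hilb J k ≤ hilb I k := by
  have h1 := hilb_add_finrank_inf I k
  have h2 := hilb_add_finrank_inf J k
  have h3 : finrank ℂ (Form k ⊓ I.restrictScalars ℂ : Submodule ℂ S)
      ≤ finrank ℂ (Form k ⊓ J.restrictScalars ℂ : Submodule ℂ S) := by
    have : FiniteDimensional ℂ (Form k ⊓ J.restrictScalars ℂ : Submodule ℂ S) :=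
      Submodule.finiteDimensional_of_le inf_le_left
    exact Submodule.finrank_mono (inf_le_inf_left _ h)
  omega

/-- The Hilbert function of the quotient by an ideal generated by forms of equal degree, in terms
of their syzygies. -/
theorem hilb_span_add [Fintype κ] {F : κ → S} {D : ℕ} (hF : ∀ i, (F i).IsHomogeneous D) {k : ℕ}
    (hk : D ≤ k) :
    hilb (Ideal.span (Set.range F)) k + Fintype.card κ * formDim (k - D)
      = formDim k
        + finrank ℂ (submodulePiece (LinearMap.ker (Fintype.linearCombination S F))
            (fun _ => D) k) := by
  rw [← hilb_add_finrank_inf (Ideal.span (Set.range F)) k, add_assoc, add_right_inj]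
  have h1 := finrank_map_add_finrank_inf_ker
    ((Fintype.linearCombination S F).restrictScalars ℂ) (gradedPiece (fun _ : κ => D) k)
  rw [finrank_gradedPiece] at h1
  simp only [Finset.sum_const, Finset.card_univ, smul_eq_mul] at h1
  rw [← h1]
  -- The row of generators is treated as a graded matrix with one column, so that the lifting lemma
  -- applies to ideals.
  have hG : IsGradedMatrix (fun i (_ : Unit) => F i) (fun _ => D) (fun _ => 0) :=
    fun i l _ => ⟨D, hF i, rfl⟩
  have hlc : ∀ p, Fintype.linearCombination S (fun i (_ : Unit) => F i) p
      = fun _ => Fintype.linearCombination S F p := by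
    intro p
    ext1 l
    rw [lc_apply]
    simp [Fintype.linearCombination_apply]
  have : (Form k ⊓ (Ideal.span (Set.range F)).restrictScalars ℂ : Submodule ℂ S)
      = (gradedPiece (fun _ => D) k).map
        ((Fintype.linearCombination S F).restrictScalars ℂ) := by
    rw [Ideal.span, span_range_eq_range_lc]
    ext v
    constructor
    · rintro ⟨h1, q, rfl⟩
      obtain ⟨p, hp, h⟩ := hG.exists_lift (k := k) (fun _ => hk) (q := q)
        (by rw [hlc, mem_gradedPiece]; exact fun _ => h1)
      refine ⟨p, hp, ?_⟩
      rw [hlc, hlc] at h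
      exact congrFun h ()
    · rintro ⟨p, hp, rfl⟩
      refine ⟨?_, p, rfl⟩
      have := hG.lc_mem (k := k) (fun _ => hk) hp
      rw [hlc, mem_gradedPiece] at this
      exact this ()
  rw [this]
  rfl

/-! ### Pairs of polynomials without a common factor -/

theorem exists_of_isRelPrime_of_mul_add_mul_eq_zero {a b α β : S} (hab : IsRelPrime a b)
    (ha : a ≠ 0) (h : α * a + β * b = 0) : ∃ δ, α = δ * b ∧ β = -(δ * a) := by
  have h1 : a ∣ β * b := ⟨-α, by linear_combination h⟩
  obtain ⟨δ, rfl⟩ := hab.dvd_of_dvd_mul_right h1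
  refine ⟨-δ, mul_right_cancel₀ ha ?_, by ring⟩
  linear_combination h

theorem not_X_dvd_X {i j : Fin 3} (h : i ≠ j) : ¬ (X i : S) ∣ X j := by
  rw [X_dvd_X]
  simpa using h

/-- The ideal is monomial, and multiplication by `X 2` does not affect the exponents of `X 0` and `X
1`. -/
theorem mem_span_X_of_X_mul_mem {γ : S}
    (h : X 2 * γ ∈ Ideal.span ({X 0, X 1} : Set S)) : γ ∈ Ideal.span ({X 0, X 1} : Set S) := by
  have hs : ({X 0, X 1} : Set S) = X '' {0, 1} := by simp [Set.image_pair]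
  rw [hs, mem_ideal_span_X_image] at h ⊢
  intro m hm
  have hm' : m + Finsupp.single 2 1 ∈ (X 2 * γ).support := by
    rw [MvPolynomial.mem_support_iff, mul_comm, coeff_mul_X]
    exact MvPolynomial.mem_support_iff.mp hm
  obtain ⟨i, hi, h0⟩ := h _ hm'
  refine ⟨i, hi, ?_⟩
  rcases hi with rfl | rfl <;> simpa using h0

/-- Exactness of the Koszul complex of `x, y, z` in homological degree one. -/
theorem koszul_exact {γ₀ γ₁ γ₂ : S} (h : X 0 * γ₀ + X 1 * γ₁ + X 2 * γ₂ = 0) :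
    ∃ δ₀ δ₁ δ₂ : S, γ₀ = X 2 * δ₁ - X 1 * δ₂ ∧ γ₁ = X 0 * δ₂ - X 2 * δ₀ ∧
      γ₂ = X 1 * δ₀ - X 0 * δ₁ := by
  have h2 : γ₂ ∈ Ideal.span ({X 0, X 1} : Set S) := by
    refine mem_span_X_of_X_mul_mem (Ideal.mem_span_pair.mpr ⟨-γ₀, -γ₁, ?_⟩)
    linear_combination -h
  obtain ⟨u, v, rfl⟩ := Ideal.mem_span_pair.mp h2
  have hX : (X 0 : S) ∣ X 1 * (γ₁ + X 2 * v) := ⟨-(γ₀ + X 2 * u), by linear_combination h⟩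
  rcases X_prime.dvd_or_dvd hX with h3 | ⟨w, hw⟩
  · exact absurd h3 (not_X_dvd_X (by decide))
  · refine ⟨v, -u, w, ?_, by linear_combination hw, by ring⟩
    apply mul_left_cancel₀ (X_ne_zero 0 : (X 0 : S) ≠ 0)
    linear_combination h - X 1 * hw

theorem X_zero_dvd_of_X_mul_eq {a b : S} (h : X 0 * a = X 1 * b) : (X 0 : S) ∣ b :=
  (X_prime.dvd_or_dvd (Dvd.intro a h)).resolve_left (not_X_dvd_X (by decide))

/-- A complete intersection of two curves has no embedded component at the irrelevant ideal. -/
theorem mem_span_pair_of_forall_X_mul_mem {a b w : S} (hab : IsRelPrime a b) (ha : a ≠ 0)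
    (h : ∀ i : Fin 3, X i * w ∈ Ideal.span {a, b}) : w ∈ Ideal.span {a, b} := by
  simp only [Ideal.mem_span_pair] at h ⊢
  choose α β hw using h
  -- Two expressions of `X i * X j * w` differ by a syzygy of the coprime pair, that is, by a Koszul
  -- multiple `γ`. The three `γ` form a Koszul cycle; writing it as a boundary `δ` allows the
  -- coefficients to be corrected so that the one for `X 0 * w` becomes divisible by `X 0`.
  have key : ∀ i j : Fin 3, ∃ γ, X j * α i - X i * α j = γ * b ∧
      X j * β i - X i * β j = -(γ * a) := fun i j =>
    exists_of_isRelPrime_of_mul_add_mul_eq_zero hab ha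
      (by linear_combination X j * hw i - X i * hw j)
  obtain ⟨γ₀, h0, h0'⟩ := key 1 2
  obtain ⟨γ₁, h1, h1'⟩ := key 2 0
  obtain ⟨γ₂, h2, h2'⟩ := key 0 1
  have hγ : X 0 * γ₀ + X 1 * γ₁ + X 2 * γ₂ = 0 := by
    refine (mul_eq_zero.mp ?_).resolve_right ha
    linear_combination X 0 * h0' + X 1 * h1' + X 2 * h2'
  obtain ⟨δ₀, δ₁, δ₂, e0, e1, e2⟩ := koszul_exact hγ
  obtain ⟨α', hα⟩ := X_zero_dvd_of_X_mul_eq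
    (show X 0 * (α 1 - δ₁ * b) = X 1 * (α 0 - δ₀ * b) by linear_combination -h2 - b * e2)
  obtain ⟨β', hβ⟩ := X_zero_dvd_of_X_mul_eq
    (show X 0 * (β 1 + δ₁ * a) = X 1 * (β 0 + δ₀ * a) by linear_combination -h2' + a * e2)
  refine ⟨α', β', ?_⟩
  apply mul_left_cancel₀ (X_ne_zero 0 : (X 0 : S) ≠ 0)
  linear_combination hw 0 - a * hα - b * hβ

theorem mem_span_pair_of_forall_form_mul_mem {a b : S} (hab : IsRelPrime a b) (ha : a ≠ 0)
    (q : ℕ) : ∀ w : S, (∀ t ∈ Form q, t * w ∈ Ideal.span {a, b}) → w ∈ Ideal.span {a, b} := by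
  induction q with
  | zero =>
    intro w h
    simpa using h 1 (isHomogeneous_one _ _)
  | succ q ih =>
    intro w h
    refine mem_span_pair_of_forall_X_mul_mem hab ha fun i => ih _ fun t ht => ?_
    rw [← mul_assoc]
    exact h _ (ht.mul (isHomogeneous_X _ i))

/-- A prime factor of `a` dividing `b + t c` for two values of `t` would divide both `c` and `b`. So
each of the finitely many prime factors excludes at most one `t`. -/
theorem finite_not_isRelPrime_add_C_mul {a b c : S} (ha : a ≠ 0)
    (h : ∀ p, Prime p → p ∣ a → p ∣ b → ¬ p ∣ c) :
    {t : ℂ | ¬ IsRelPrime a (b + C t * c)}.Finite := by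
  have hfin : {q : S | q ∈ UniqueFactorizationMonoid.factors a}.Finite :=
    Multiset.finite_toSet _
  refine (hfin.biUnion (t := fun q => {t : ℂ | Prime q ∧ q ∣ a ∧ q ∣ b + C t * c})
    fun q _ => Set.Subsingleton.finite ?_).subset ?_
  · rintro t ⟨hq, hqa, ht⟩ t' ⟨-, -, ht'⟩
    by_contra hne
    have h1 : q ∣ C (t - t') * c := by
      have := dvd_sub ht ht'
      rwa [show b + C t * c - (b + C t' * c) = C (t - t') * c by rw [C_sub]; ring] at this
    have hu : IsUnit (C (t - t') : S) := (isUnit_iff_ne_zero.mpr (sub_ne_zero.mpr hne)).map C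
    have hqc : q ∣ c := hu.dvd_mul_left.mp h1
    exact h q hq hqa ((dvd_add_left (hqc.mul_left _)).mp ht) hqc
  · intro t ht
    simp only [Set.mem_ofPred_eq, IsRelPrime, not_forall] at ht
    obtain ⟨e, he, he', hu⟩ := ht
    have he0 : e ≠ 0 := fun h0 => ha (zero_dvd_iff.mp (h0 ▸ he))
    obtain ⟨p, hp, hpe⟩ := WfDvdMonoid.exists_irreducible_factor hu he0
    obtain ⟨q, hq, hpq⟩ := UniqueFactorizationMonoid.exists_mem_factors_of_dvd ha hp (hpe.trans he)
    simp only [Set.mem_iUnion, Set.mem_ofPred_eq]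
    exact ⟨q, hq, UniqueFactorizationMonoid.prime_of_factor q hq,
      UniqueFactorizationMonoid.dvd_of_mem_factors hq, hpq.symm.dvd.trans (hpe.trans he')⟩

theorem finite_add_C_mul_eq_zero {b c : S} (h : b ≠ 0 ∨ c ≠ 0) :
    {t : ℂ | b + C t * c = 0}.Finite := by
  refine Set.Subsingleton.finite fun t ht t' ht' => ?_
  by_contra hne
  have h1 : C (t - t') * c = 0 := by
    rw [C_sub]
    have e : b + C t * c = 0 := ht
    have e' : b + C t' * c = 0 := ht'
    linear_combination e - e'
  have hc : c = 0 := (mul_eq_zero.mp h1).resolve_left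
    (by simpa [sub_eq_zero] using hne)
  have hb : b = 0 := by simpa [hc] using ht
  simp [hb, hc] at h

/-- A family of polynomials without a common prime factor. -/
def NoCommonPrime (F : Fin 3 → S) : Prop := ∀ p, Prime p → ∃ i, ¬ p ∣ F i

/-! ### The submodule generated by a syzygy and two Koszul syzygies -/

/-- `ρ` is a syzygy of degree `r` of the triple `F` of forms of degree `D` which, together with two
syzygies of degree `D`, generates a module with a free resolution of length one, and which is the
module of all syzygies if it agrees with it in all large degrees. -/
def HasKoszulPair (F : Fin 3 → S) (D : ℕ) (ρ : Fin 3 → S) (r : ℕ) : Prop :=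
  ∃ K₁ K₂ : Fin 3 → S, (∀ l, (K₁ l).IsHomogeneous D) ∧ (∀ l, (K₂ l).IsHomogeneous D) ∧
    Submodule.span S (Set.range ![ρ, K₁, K₂]) ≤ LinearMap.ker (Fintype.linearCombination S F) ∧
    (∀ k, 2 * D + r ≤ k →
      finrank ℂ (submodulePiece (Submodule.span S (Set.range ![ρ, K₁, K₂])) (fun _ => D) k)
        + formDim (k - (2 * D + r))
        = formDim (k - (D + r)) + 2 * formDim (k - 2 * D)) ∧
    ((∃ k₀, ∀ k, k₀ ≤ k →
      submodulePiece (LinearMap.ker (Fintype.linearCombination S F)) (fun _ => D) k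
        ≤ submodulePiece (Submodule.span S (Set.range ![ρ, K₁, K₂])) (fun _ => D) k) →
      LinearMap.ker (Fintype.linearCombination S F)
        ≤ Submodule.span S (Set.range ![ρ, K₁, K₂])) ∧
    (∀ k, 2 * D ≤ k → hilb (Ideal.span (Set.range F)) k ≤ D ^ 2)

theorem lc_three {M : Type*} [AddCommGroup M] [Module S M] (F : Fin 3 → M) (p : Fin 3 → S) :
    Fintype.linearCombination S F p = p 0 • F 0 + p 1 • F 1 + p 2 • F 2 := by
  rw [Fintype.linearCombination_apply, Fin.sum_univ_three]

/-- Bézout: the Koszul resolution of a complete intersection of type `(D, D)` gives length `D²` in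
all degrees from `2 * D` on. -/
theorem hilb_span_pair {a b : S} {D : ℕ} (ha : a.IsHomogeneous D) (hb : b.IsHomogeneous D)
    (hab : IsRelPrime a b) (ha0 : a ≠ 0) {k : ℕ} (hk : 2 * D ≤ k) :
    hilb (Ideal.span {a, b}) k = D ^ 2 := by
  have hF : ∀ i, (![a, b] i).IsHomogeneous D := by
    intro i; fin_cases i <;> assumption
  have h1 := hilb_span_add hF (k := k) (by omega)
  have hG : IsGradedMatrix (fun (_ : Fin 1) => ![b, -a]) (fun _ => 2 * D) (fun _ => D) := by
    intro i l _
    refine ⟨D, ?_, (two_mul D).symm⟩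
    fin_cases l
    · exact hb
    · exact ha.neg
  have hker : Submodule.span S (Set.range fun (_ : Fin 1) => ![b, -a])
      = LinearMap.ker (Fintype.linearCombination S ![a, b]) := by
    rw [Set.range_const]
    ext v
    rw [Submodule.mem_span_singleton, LinearMap.mem_ker, Fintype.linearCombination_apply,
      Fin.sum_univ_two]
    simp only [Matrix.cons_val_zero, Matrix.cons_val_one, smul_eq_mul]
    constructor
    · rintro ⟨c, rfl⟩
      simp only [Pi.smul_apply, Matrix.cons_val_zero, Matrix.cons_val_one, smul_eq_mul]
      ring
    · intro h
      obtain ⟨δ, h0, h1⟩ := exists_of_isRelPrime_of_mul_add_mul_eq_zero hab ha0 h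
      refine ⟨δ, ?_⟩
      ext1 l
      fin_cases l
      · simp [h0]
      · simp [h1]
  -- The single Koszul syzygy has no relations because `a ≠ 0`, so the next term of the resolution
  -- is empty.
  have hR : Submodule.span S (Set.range (Fin.elim0 : Fin 0 → Fin 1 → S))
      = LinearMap.ker (Fintype.linearCombination S fun (_ : Fin 1) => ![b, -a]) := by
    rw [Set.range_eq_empty, Submodule.span_empty, eq_comm, LinearMap.ker_eq_bot']
    intro m hm
    have := congrFun hm 1
    rw [lc_apply] at this
    ext1 i
    fin_cases i
    simpa [ha0] using this
  have h2 := finrank_span_of_resolution (γ := Fin.elim0) hG (fun i => i.elim0) hR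
    (linearIndependent_empty_type) (k := k) (fun _ => hk) (fun j => j.elim0)
  rw [hker] at h2
  simp only [Finset.univ_eq_empty, Finset.sum_empty, add_zero, Finset.univ_unique,
    Finset.sum_const, Finset.card_singleton, one_smul] at h2
  rw [h2] at h1
  have hr : Set.range ![a, b] = {a, b} := by simp [Set.pair_comm]
  rw [hr, Fintype.card_fin] at h1
  have h3 := two_mul_formDim k
  have h4 := two_mul_formDim_sub (a := D) (k := k) (by omega)
  have h5 := two_mul_formDim_sub hk
  have h1' : (hilb (Ideal.span {a, b}) k : ℚ) + 2 * formDim (k - D)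
      = formDim k + formDim (k - 2 * D) := by exact_mod_cast h1
  have : (hilb (Ideal.span {a, b}) k : ℚ) = (D : ℚ) ^ 2 := by
    push_cast at h5
    linarith
  exact_mod_cast this

theorem homogeneousComponent_syzygy {κ : Type*} [Fintype κ] {F : κ → S} {D : ℕ}
    (hF : ∀ i, (F i).IsHomogeneous D) {s : κ → S}
    (hs : s ∈ LinearMap.ker (Fintype.linearCombination S F)) (e : ℕ) :
    (fun i => homogeneousComponent e (s i)) ∈ LinearMap.ker (Fintype.linearCombination S F) := by
  rw [LinearMap.mem_ker, Fintype.linearCombination_apply] at hs ⊢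
  have := congrArg (homogeneousComponent (e + D)) hs
  rw [map_sum, map_zero] at this
  rw [← this]
  refine Finset.sum_congr rfl fun i _ => ?_
  rw [smul_eq_mul, smul_eq_mul, homogeneousComponent_mul_of_isHomogeneous (hF i) (by omega),
    Nat.add_sub_cancel]

/-- The heart of the argument in general position. Coprimality of `g 0, ρ 2` controls both the
relations among the three syzygies and the saturation; coprimality of `g 0, g 1` gives the
membership criterion by last entries and the bound `D ^ 2`. -/
theorem hasKoszulPair_of_isRelPrime {g : Fin 3 → S} {D : ℕ} (hg : ∀ i, (g i).IsHomogeneous D)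
    {ρ : Fin 3 → S} {r : ℕ} (hρ : ∀ i, (ρ i).IsHomogeneous r)
    (hs : Fintype.linearCombination S g ρ = 0) (hg0 : g 0 ≠ 0)
    (h01 : IsRelPrime (g 0) (g 1)) (h02 : IsRelPrime (g 0) (ρ 2)) : HasKoszulPair g D ρ r := by
  have hs' : ρ 0 * g 0 + ρ 1 * g 1 + ρ 2 * g 2 = 0 := by simpa [lc_three] using hs
  set W : Fin 3 → Fin 3 → S := ![ρ, ![-g 2, 0, g 0], ![g 1, -g 0, 0]] with hW
  have hlcW : ∀ p, Fintype.linearCombination S W p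
      = ![p 0 * ρ 0 - p 1 * g 2 + p 2 * g 1, p 0 * ρ 1 - p 2 * g 0, p 0 * ρ 2 + p 1 * g 0] := by
    intro p
    rw [lc_three]
    ext1 l
    fin_cases l <;> simp only [hW, Pi.add_apply, Pi.smul_apply, smul_eq_mul, Matrix.cons_val,
      Fin.zero_eta, Fin.mk_one, Fin.reduceFinMk] <;> ring
  refine ⟨![-g 2, 0, g 0], ![g 1, -g 0, 0], ?_, ?_, ?_, ?_, ?_, ?_⟩
  · intro l
    fin_cases l
    · exact (hg 2).neg
    · exact isHomogeneous_zero _ _ _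
    · exact hg 0
  · intro l
    fin_cases l
    · exact hg 1
    · exact (hg 0).neg
    · exact isHomogeneous_zero _ _ _
  · rw [span_range_eq_range_lc]
    rintro _ ⟨p, rfl⟩
    rw [LinearMap.mem_ker, hlcW, lc_three]
    simp only [smul_eq_mul, Matrix.cons_val]
    linear_combination p 0 * hs'
  · intro k hk
    have hGW : IsGradedMatrix W ![D + r, 2 * D, 2 * D] (fun _ => D) := by
      intro i l h0
      fin_cases i
      · exact ⟨r, hρ l, by simp [add_comm]⟩
      · refine ⟨D, ?_, by simp [two_mul]⟩
        fin_cases l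
        · exact (hg 2).neg
        · exact isHomogeneous_zero _ _ _
        · exact hg 0
      · refine ⟨D, ?_, by simp [two_mul]⟩
        fin_cases l
        · exact hg 1
        · exact (hg 0).neg
        · exact isHomogeneous_zero _ _ _
    have hR : IsGradedMatrix (fun _ : Fin 1 => ![g 0, -ρ 2, ρ 1]) (fun _ => 2 * D + r)
        ![D + r, 2 * D, 2 * D] := by
      intro i l h0
      fin_cases l
      · exact ⟨D, hg 0, by simp only [Fin.zero_eta, Matrix.cons_val_zero]; omega⟩
      · exact ⟨r, (hρ 2).neg, by simp [add_comm]⟩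
      · exact ⟨r, hρ 1, by simp [add_comm]⟩
    -- The last coordinate of a relation reads `p 0 * ρ 2 + p 1 * g 0 = 0`, so coprimality
    -- determines `p 0` and `p 1` up to a common factor; the middle coordinate then determines `p
    -- 2`.
    have hker : Submodule.span S (Set.range fun _ : Fin 1 => ![g 0, -ρ 2, ρ 1])
        = LinearMap.ker (Fintype.linearCombination S W) := by
      rw [Set.range_const]
      ext v
      rw [Submodule.mem_span_singleton, LinearMap.mem_ker, hlcW]
      constructor
      · rintro ⟨c, rfl⟩
        ext1 l
        fin_cases l
        · simp
          linear_combination c * hs'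
        · simp
          ring
        · simp
          ring
      · intro h
        have h1 := congrFun h 1
        have h2 := congrFun h 2
        simp only [Matrix.cons_val, Pi.zero_apply] at h1 h2
        obtain ⟨δ, hδ, hδ'⟩ := exists_of_isRelPrime_of_mul_add_mul_eq_zero h02 hg0
          (show v 1 * g 0 + v 0 * ρ 2 = 0 by linear_combination h2)
        refine ⟨-δ, ?_⟩
        ext1 l
        fin_cases l
        · simp [hδ']
        · simp [hδ]
        · apply mul_right_cancel₀ hg0
          simp
          rw [hδ'] at h1
          linear_combination h1
    have hinj : LinearIndependent S (fun _ : Fin 1 => ![g 0, -ρ 2, ρ 1]) := by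
      rw [linearIndependent_unique_iff]
      intro h
      exact hg0 (by simpa using congrFun h 0)
    have := finrank_span_of_resolution hGW hR hker hinj (k := k)
      (by intro i; fin_cases i <;> simp <;> omega) (fun _ => hk)
    simp only [Finset.univ_unique, Finset.sum_const, Finset.card_singleton, one_smul,
      Fin.sum_univ_three, Matrix.cons_val] at this
    rw [this]
    ring
  · rintro ⟨k₀, hk₀⟩ s hsy
    have hthird : ∀ v ∈ Submodule.span S (Set.range W), v 2 ∈ Ideal.span {g 0, ρ 2} := by
      rw [span_range_eq_range_lc]
      rintro _ ⟨p, rfl⟩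
      rw [hlcW, Ideal.mem_span_pair]
      exact ⟨p 1, p 0, by simp [add_comm]⟩
    -- Multiplying a homogeneous component of `s` by any form of degree `k₀` moves it into the range
    -- where the two modules agree. Saturatedness of `(g 0, ρ 2)` then removes the multiplier.
    have hw : s 2 ∈ Ideal.span {g 0, ρ 2} := by
      rw [← sum_homogeneousComponent (s 2)]
      refine Ideal.sum_mem _ fun e _ => ?_
      refine mem_span_pair_of_forall_form_mul_mem h02 hg0 k₀ _ fun t ht => ?_
      have hmem : t • (fun i => homogeneousComponent e (s i)) ∈
          submodulePiece (LinearMap.ker (Fintype.linearCombination S g)) (fun _ => D)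
            (k₀ + e + D) := by
        refine ⟨mem_gradedPiece.mpr fun l => ?_, ?_⟩
        · rw [Nat.add_sub_cancel]
          exact ht.mul (homogeneousComponent_isHomogeneous _ _)
        · exact Submodule.smul_mem _ t (homogeneousComponent_syzygy hg hsy e)
      exact hthird _ (hk₀ _ (by omega) hmem).2
    obtain ⟨β, α, hαβ⟩ := Ideal.mem_span_pair.mp hw
    rw [LinearMap.mem_ker, lc_three] at hsy
    simp only [smul_eq_mul] at hsy
    -- Subtracting `α • ρ` and `β` times the first Koszul syzygy kills the last entry; what remains
    -- is a syzygy of `g 0, g 1` alone.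
    obtain ⟨δ, h0, h1⟩ := exists_of_isRelPrime_of_mul_add_mul_eq_zero h01 hg0
      (show (s 0 - α * ρ 0 + β * g 2) * g 0 + (s 1 - α * ρ 1) * g 1 = 0 by
        linear_combination hsy - α * hs' + g 2 * hαβ)
    change s ∈ Submodule.span S (Set.range W)
    rw [span_range_eq_range_lc]
    refine ⟨![α, β, δ], ?_⟩
    rw [hlcW]
    ext1 l
    fin_cases l
    · simp
      linear_combination -h0
    · simp
      linear_combination -h1
    · simp
      linear_combination hαβ
  · intro k hk
    rw [← hilb_span_pair (hg 0) (hg 1) h01 hg0 hk]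
    refine hilb_anti (Ideal.span_mono ?_) k
    rintro _ (rfl | rfl)
    exacts [⟨0, rfl⟩, ⟨1, rfl⟩]

/-! ### Generic linear changes of the generators -/

/-- Every clause is invariant under an automorphism of `S³` that preserves degrees and intertwines
the two triples; in particular both triples generate the same ideal. -/
theorem HasKoszulPair.transport {F g : Fin 3 → S} {D : ℕ} {ρ : Fin 3 → S} {r : ℕ}
    (Φ : (Fin 3 → S) ≃ₗ[S] (Fin 3 → S))
    (hΦ : ∀ e v, (∀ l, (Φ v l).IsHomogeneous e) ↔ ∀ l, (v l).IsHomogeneous e)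
    (hlc : ∀ v, Fintype.linearCombination S F (Φ v) = Fintype.linearCombination S g v)
    (h : HasKoszulPair g D ρ r) : HasKoszulPair F D (Φ ρ) r := by
  obtain ⟨K₁, K₂, h1, h2, hle, hdim, hsat, hhilb⟩ := h
  have hspan : Submodule.span S (Set.range ![Φ ρ, Φ K₁, Φ K₂])
      = (Submodule.span S (Set.range ![ρ, K₁, K₂])).map Φ.toLinearMap := by
    rw [Submodule.map_span, ← Set.range_comp]
    congr 2
    ext1 i
    fin_cases i <;> rfl
  have hker : LinearMap.ker (Fintype.linearCombination S F)
      = (LinearMap.ker (Fintype.linearCombination S g)).map Φ.toLinearMap := by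
    ext v
    obtain ⟨w, rfl⟩ := Φ.surjective v
    simp only [LinearMap.mem_ker, hlc, Submodule.mem_map, LinearEquiv.coe_coe,
      EmbeddingLike.apply_eq_iff_eq, exists_eq_right]
  have hpiece : ∀ (N : Submodule S (Fin 3 → S)) k, submodulePiece (N.map Φ.toLinearMap)
      (fun _ => D) k
      = (submodulePiece N (fun _ => D) k).map (Φ.restrictScalars ℂ).toLinearMap := by
    intro N k
    ext v
    obtain ⟨w, rfl⟩ := Φ.surjective v
    have : Φ w ∈ (submodulePiece N (fun _ => D) k).map (Φ.restrictScalars ℂ).toLinearMap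
        ↔ w ∈ submodulePiece N (fun _ => D) k := by
      constructor
      · rintro ⟨w', hw', he⟩
        rwa [← Φ.injective he]
      · exact fun hw => ⟨w, hw, rfl⟩
    rw [this]
    simp only [Submodule.mem_inf, mem_gradedPiece, hΦ, Submodule.restrictScalars_mem,
      Submodule.mem_map, LinearEquiv.coe_coe, EmbeddingLike.apply_eq_iff_eq, exists_eq_right]
  refine ⟨Φ K₁, Φ K₂, (hΦ _ _).mpr h1, (hΦ _ _).mpr h2, ?_, ?_, ?_, ?_⟩
  · rw [hspan, hker]
    exact Submodule.map_mono hle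
  · intro k hk
    rw [hspan, hpiece, LinearEquiv.finrank_map_eq (Φ.restrictScalars ℂ)]
    exact hdim k hk
  · rintro ⟨k₀, hk₀⟩
    rw [hspan, hker]
    refine Submodule.map_mono (hsat ⟨k₀, fun k hk => ?_⟩)
    have := hk₀ k hk
    rw [hspan, hker, hpiece, hpiece] at this
    exact (Submodule.map_le_map_iff_of_injective (Φ.restrictScalars ℂ).injective _ _).mp this
  · intro k hk
    have : Ideal.span (Set.range F) = Ideal.span (Set.range g) := by
      rw [Ideal.span, Ideal.span, span_range_eq_range_lc, span_range_eq_range_lc]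
      ext x
      constructor
      · rintro ⟨v, rfl⟩
        exact ⟨Φ.symm v, by rw [← hlc, Φ.apply_symm_apply]⟩
      · rintro ⟨v, rfl⟩
        exact ⟨Φ v, hlc v⟩
    rw [this]
    exact hhilb k hk

/-- The elementary transformation adding `c` times the `i`-th entry to the `j`-th entry. -/
def shear {i j : Fin 3} (hij : i ≠ j) (c : ℂ) : (Fin 3 → S) ≃ₗ[S] (Fin 3 → S) where
  toFun v := v + Pi.single j (C c * v i)
  invFun v := v - Pi.single j (C c * v i)
  map_add' v w := by
    ext1 l
    by_cases h : l = j
    · subst h; simp; ring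
    · simp [h]
  map_smul' a v := by
    ext1 l
    by_cases h : l = j
    · subst h; simp; ring
    · simp [h]
  left_inv v := by simp [hij]
  right_inv v := by simp [hij]

theorem shear_symm_apply {i j : Fin 3} (hij : i ≠ j) (c : ℂ) (v : Fin 3 → S) :
    (shear hij c).symm v = v - Pi.single j (C c * v i) := rfl

theorem shear_apply {i j : Fin 3} (hij : i ≠ j) (c : ℂ) (v : Fin 3 → S) :
    shear hij c v = v + Pi.single j (C c * v i) := rfl

theorem isHomogeneous_add_single {j : Fin 3} {v : Fin 3 → S} {e : ℕ} {p : S}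
    (hv : ∀ l, (v l).IsHomogeneous e) (hp : p.IsHomogeneous e) (l : Fin 3) :
    ((v + Pi.single j p : Fin 3 → S) l).IsHomogeneous e := by
  by_cases h : l = j
  · subst h
    simpa using (hv l).add hp
  · simpa [h] using hv l

theorem isHomogeneous_shear_symm {i j : Fin 3} (hij : i ≠ j) (c : ℂ) {v : Fin 3 → S} {e : ℕ}
    (hv : ∀ l, (v l).IsHomogeneous e) (l : Fin 3) :
    ((shear hij c).symm v l).IsHomogeneous e := by
  rw [shear_symm_apply, sub_eq_add_neg, ← Pi.single_neg]
  exact isHomogeneous_add_single hv ((hv i).C_mul c).neg l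

theorem isHomogeneous_shear_iff {i j : Fin 3} (hij : i ≠ j) (c : ℂ) (e : ℕ) (v : Fin 3 → S) :
    (∀ l, (shear hij c v l).IsHomogeneous e) ↔ ∀ l, (v l).IsHomogeneous e := by
  constructor
  · intro h
    have := isHomogeneous_shear_symm hij c h
    rwa [LinearEquiv.symm_apply_apply] at this
  · exact fun hv => isHomogeneous_add_single hv ((hv i).C_mul c)

/-- A shear of the syzygies is adjoint to the opposite shear of the triple: `F i` receives `c * F j`
when `v j` receives `c * v i`. -/
theorem lc_shear {i j : Fin 3} (hij : i ≠ j) (c : ℂ) (F v : Fin 3 → S) :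
    Fintype.linearCombination S F (shear hij c v)
      = Fintype.linearCombination S (F + Pi.single i (C c * F j)) v := by
  simp only [Fintype.linearCombination_apply, shear_apply, smul_eq_mul, Pi.add_apply, add_mul,
    mul_add, Finset.sum_add_distrib, add_right_inj]
  rw [Finset.sum_eq_single j (by intro b _ hb; simp [hb]) (by simp),
    Finset.sum_eq_single i (by intro b _ hb; simp [hb]) (by simp)]
  simp
  ring

theorem HasKoszulPair.of_shear {i j : Fin 3} (hij : i ≠ j) (c : ℂ) {F : Fin 3 → S} {D : ℕ}
    {ρ : Fin 3 → S} {r : ℕ}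
    (h : HasKoszulPair (F + Pi.single i (C c * F j)) D (ρ - Pi.single j (C c * ρ i)) r) :
    HasKoszulPair F D ρ r := by
  have := h.transport (shear hij c) (isHomogeneous_shear_iff hij c)
    (lc_shear hij c F)
  rwa [← shear_symm_apply hij, LinearEquiv.apply_symm_apply] at this

theorem lc_shear_symm {i j : Fin 3} (hij : i ≠ j) (c : ℂ) (F ρ : Fin 3 → S) :
    Fintype.linearCombination S (F + Pi.single i (C c * F j)) (ρ - Pi.single j (C c * ρ i))
      = Fintype.linearCombination S F ρ := by
  rw [← lc_shear hij, ← shear_symm_apply hij, LinearEquiv.apply_symm_apply]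

theorem NoCommonPrime.add_single {i j : Fin 3} (hij : i ≠ j) (c : ℂ) {F : Fin 3 → S}
    (h : NoCommonPrime F) : NoCommonPrime (F + Pi.single i (C c * F j)) := by
  intro p hp
  by_contra! hall
  obtain ⟨l, hl⟩ := h p hp
  have hj : p ∣ F j := by simpa [hij.symm] using hall j
  apply hl
  by_cases hli : l = i
  · subst hli
    have := hall l
    simp only [Pi.add_apply, Pi.single_eq_same] at this
    exact (dvd_add_left (hj.mul_left _)).mp this
  · simpa [hli] using hall l

theorem exists_prime_dvd_of_isHomogeneous {p : S} {D : ℕ} (hD : 1 ≤ D) (hp : p.IsHomogeneous D) :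
    ∃ q, Prime q ∧ q ∣ p := by
  by_cases h0 : p = 0
  · exact ⟨X 0, X_prime, h0 ▸ dvd_zero _⟩
  have hu : ¬ IsUnit p := by
    intro hu
    rw [isUnit_iff_totalDegree_of_isReduced] at hu
    have := hp.totalDegree h0
    omega
  obtain ⟨q, hq, hqp⟩ := WfDvdMonoid.exists_irreducible_factor hu h0
  exact ⟨q, hq.prime, hqp⟩

/-- Three successive shears reach general position, each avoiding finitely many constants. The
second leaves the first entry of the triple unchanged and keeps the last entry of the syzygy
nonzero; the third does not change that last entry and preserves coprimality of the first two
members of the triple. -/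
theorem hasKoszulPair_of_ne_zero {F : Fin 3 → S} {D : ℕ} (hD : 1 ≤ D)
    (hF : ∀ i, (F i).IsHomogeneous D) (hcop : NoCommonPrime F) {ρ : Fin 3 → S} {r : ℕ}
    (hρ : ∀ i, (ρ i).IsHomogeneous r) (hs : Fintype.linearCombination S F ρ = 0)
    (h2 : ρ 2 ≠ 0) : HasKoszulPair F D ρ r := by
  have d02 : (0 : Fin 3) ≠ 2 := by decide
  have d12 : (1 : Fin 3) ≠ 2 := by decide
  have d01 : (0 : Fin 3) ≠ 1 := by decide
  -- the first entry becomes nonzero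
  have hne : F 0 ≠ 0 ∨ F 2 ≠ 0 := by
    by_contra! h
    -- If two entries vanish, a prime factor of the third divides all of them; `1 ≤ D` excludes a
    -- unit.
    obtain ⟨q, hq, hq1⟩ := exists_prime_dvd_of_isHomogeneous hD (hF 1)
    obtain ⟨i, hi⟩ := hcop q hq
    fin_cases i
    · exact hi (by simp [h.1])
    · exact hi hq1
    · exact hi (by simp [h.2])
  obtain ⟨s, hsA⟩ := ((finite_add_C_mul_eq_zero hne).union
    (finite_add_C_mul_eq_zero (b := ρ 2) (c := -ρ 0) (Or.inl h2))).infinite_compl.nonempty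
  simp only [Set.mem_compl_iff, Set.mem_union, Set.mem_ofPred_eq, not_or] at hsA
  apply HasKoszulPair.of_shear d02 s
  have hs' := lc_shear_symm d02 s F ρ
  rw [hs] at hs'
  set F' := F + Pi.single 0 (C s * F 2) with hF'
  set ρ' := ρ - Pi.single 2 (C s * ρ 0) with hρ'
  have hF'h : ∀ i, (F' i).IsHomogeneous D := isHomogeneous_add_single hF ((hF 2).C_mul s)
  have hρ'h : ∀ i, (ρ' i).IsHomogeneous r := isHomogeneous_shear_symm d02 s hρ
  have hcop' : NoCommonPrime F' := hcop.add_single d02 s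
  have hF0 : F' 0 ≠ 0 := by simpa [hF'] using hsA.1
  have hρ2 : ρ' 2 ≠ 0 := by
    have := hsA.2
    rwa [mul_neg, ← sub_eq_add_neg] at this
  clear_value F' ρ'
  clear hF' hρ'
  -- the first two entries become coprime
  obtain ⟨t, htA⟩ := ((finite_not_isRelPrime_add_C_mul (b := F' 1) (c := F' 2) hF0
      (by
        intro p hp h0 h1 h2
        obtain ⟨i, hi⟩ := hcop' p hp
        fin_cases i <;> contradiction)).union
    (finite_add_C_mul_eq_zero (b := ρ' 2) (c := -ρ' 1) (Or.inl hρ2))).infinite_compl.nonempty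
  simp only [Set.mem_compl_iff, Set.mem_union, Set.mem_ofPred_eq, not_or, not_not] at htA
  apply HasKoszulPair.of_shear d12 t
  have hs'' := lc_shear_symm d12 t F' ρ'
  rw [hs'] at hs''
  set F'' := F' + Pi.single 1 (C t * F' 2) with hF''
  set ρ'' := ρ' - Pi.single 2 (C t * ρ' 1) with hρ''
  have hF''h : ∀ i, (F'' i).IsHomogeneous D := isHomogeneous_add_single hF'h ((hF'h 2).C_mul t)
  have hρ''h : ∀ i, (ρ'' i).IsHomogeneous r := isHomogeneous_shear_symm d12 t hρ'h
  have hF0'' : F'' 0 ≠ 0 := by simpa [hF''] using hF0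
  have h01 : IsRelPrime (F'' 0) (F'' 1) := by simpa [hF''] using htA.1
  have hρ2'' : ρ'' 2 ≠ 0 := by
    have := htA.2
    rwa [mul_neg, ← sub_eq_add_neg] at this
  clear_value F'' ρ''
  -- the first entry becomes coprime to the last entry of the syzygy
  obtain ⟨u, huA⟩ := ((finite_not_isRelPrime_add_C_mul (b := F'' 0) (c := F'' 1) hρ2''
      (fun p hp _ h0 h1 => hp.not_isUnit (h01 h0 h1))).union
    (finite_add_C_mul_eq_zero (b := F'' 0) (c := F'' 1) (Or.inl hF0''))).infinite_compl.nonempty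
  simp only [Set.mem_compl_iff, Set.mem_union, Set.mem_ofPred_eq, not_or, not_not] at huA
  apply HasKoszulPair.of_shear d01 u
  have e0 : (F'' + Pi.single 0 (C u * F'' 1) : Fin 3 → S) 0 = F'' 0 + C u * F'' 1 := by simp
  refine hasKoszulPair_of_isRelPrime (isHomogeneous_add_single hF''h ((hF''h 1).C_mul u))
    (isHomogeneous_shear_symm d01 u hρ''h) ?_ ?_ ?_ ?_
  · rw [lc_shear_symm d01, hs'']
  · rw [e0]
    exact huA.2
  · rw [e0]
    intro p hp hp'
    have h1 : p ∣ F'' 1 := by simpa using hp'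
    exact h01 ((dvd_add_left (h1.mul_left _)).mp hp) h1
  · rw [e0]
    simpa using huA.1.symm

theorem hasKoszulPair {F : Fin 3 → S} {D : ℕ} (hD : 1 ≤ D)
    (hF : ∀ i, (F i).IsHomogeneous D) (hcop : NoCommonPrime F) {ρ : Fin 3 → S} {r : ℕ}
    (hρ : ∀ i, (ρ i).IsHomogeneous r) (hs : Fintype.linearCombination S F ρ = 0)
    (h0 : ρ ≠ 0) : HasKoszulPair F D ρ r := by
  obtain ⟨i, hi⟩ := Function.ne_iff.mp h0
  let σ : Equiv.Perm (Fin 3) := Equiv.swap i 2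
  have hlc : ∀ v, Fintype.linearCombination S F (LinearEquiv.funCongrLeft S S σ v)
      = Fintype.linearCombination S (F ∘ σ) v := by
    intro v
    simp only [Fintype.linearCombination_apply, LinearEquiv.funCongrLeft_apply,
      LinearMap.funLeft_apply, Function.comp_apply]
    rw [← Equiv.sum_comp σ]
    simp [σ]
  have hσσ : LinearEquiv.funCongrLeft S S σ (ρ ∘ σ) = ρ := by
    ext1 l
    simp [LinearEquiv.funCongrLeft_apply, LinearMap.funLeft_apply, σ]
  rw [← hσσ]
  refine HasKoszulPair.transport (g := F ∘ σ) _ ?_ hlc ?_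
  · intro e v
    exact σ.forall_congr_right (q := fun l => (v l).IsHomogeneous e)
  · refine hasKoszulPair_of_ne_zero hD (fun l => hF _) ?_ (fun l => hρ _) ?_ ?_
    · intro p hp
      obtain ⟨l, hl⟩ := hcop p hp
      exact ⟨σ l, by simpa [σ] using hl⟩
    · exact (hlc _).symm.trans (by rw [hσσ, hs])
    · simpa [σ] using hi

/-! ### The partial derivatives of a reduced curve -/

/-- A nonzero `∂p/∂x_i` has smaller degree in `x_i` than `p`. -/
theorem dvd_pderiv_imp_eq_zero {p : S} {i : Fin 3} (h : p ∣ pderiv i p) : pderiv i p = 0 := by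
  by_contra h0
  obtain ⟨q, hq⟩ := h
  have hp0 : p ≠ 0 := by rintro rfl; simp at h0
  have hq0 : q ≠ 0 := by rintro rfl; simp [hq] at h0
  have h1 : degreeOf i (pderiv i p) < degreeOf i p := by
    have hm : ∀ m ∈ (pderiv i p).support, m i < degreeOf i p := by
      intro m hm
      rw [MvPolynomial.mem_support_iff, coeff_pderiv] at hm
      have := monomial_le_degreeOf i (MvPolynomial.mem_support_iff.mpr (left_ne_zero_of_mul hm))
      simp only [Finsupp.add_apply, Finsupp.single_eq_same] at this
      omega
    obtain ⟨m, hms⟩ := support_nonempty.mpr h0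
    exact (degreeOf_lt_iff ((Nat.zero_le _).trans_lt (hm m hms))).mpr hm
  rw [hq, degreeOf_mul_eq hp0 hq0] at h1
  omega

theorem eq_C_of_forall_pderiv_eq_zero {p : S} (h : ∀ i, pderiv i p = 0) :
    p = C (constantCoeff p) := by
  ext m
  rw [coeff_C]
  split_ifs with h0
  · rw [← h0, constantCoeff_eq]
  · obtain ⟨i, hi⟩ := Finsupp.ne_iff.mp (Ne.symm h0)
    have h1 := coeff_pderiv (i := i) p (m - Finsupp.single i 1)
    rw [h i, coeff_zero, tsub_add_cancel_of_le
      (Finsupp.single_le_iff.mpr (Nat.one_le_iff_ne_zero.mpr hi))] at h1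
    exact (mul_eq_zero.mp h1.symm).resolve_right (Nat.cast_add_one_ne_zero _)

/-- By Euler's identity a common prime `p` of the partials divides `f = p q`, and squarefreeness
gives `p ∤ q`. The product rule then makes `p` divide its own partials, which therefore vanish, so
`p` is constant. -/
theorem IsReducedCurve.noCommonPrime {f : S} {d : ℕ} (hf : IsReducedCurve f d) (hd : 1 ≤ d) :
    NoCommonPrime (fun i => pderiv i f) := by
  intro p hp
  by_contra! hall
  have hE := hf.homogeneous.sum_X_mul_pderiv
  have hpf : p ∣ f := by
    have h1 : p ∣ d • f := hE ▸ Finset.dvd_sum fun i _ => (hall i).mul_left _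
    have hu : IsUnit (C (d : ℂ) : S) :=
      (isUnit_iff_ne_zero.mpr (by exact_mod_cast (by omega : d ≠ 0))).map C
    rw [nsmul_eq_mul, show ((d : ℕ) : S) = C (d : ℂ) by simp] at h1
    exact hu.dvd_mul_left.mp h1
  obtain ⟨q, hq⟩ := hpf
  have hpq : ¬ p ∣ q := by
    rintro ⟨w, rfl⟩
    exact hp.not_isUnit (hf.squarefree p ⟨w, by rw [hq]; ring⟩)
  have hz : ∀ i, pderiv i p = 0 := by
    intro i
    apply dvd_pderiv_imp_eq_zero
    have h1 := hall i
    simp only [hq, pderiv_mul] at h1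
    exact (hp.dvd_or_dvd ((dvd_add_left (Dvd.intro _ rfl)).mp h1)).resolve_right hpq
  have := eq_C_of_forall_pderiv_eq_zero hz
  apply hp.not_isUnit
  rw [this]
  refine (isUnit_iff_ne_zero.mpr fun h0 => hp.ne_zero ?_).map C
  rw [this, h0, C_0]

/-! ### Hilbert functions and affine charts -/

attribute [local instance] MvPolynomial.gradedAlgebra

/-- `I` is a homogeneous ideal of `ℂ[x, y, z]`. -/
abbrev IsHomogeneousIdeal (I : Ideal S) : Prop :=
  I.IsHomogeneous (homogeneousSubmodule (Fin 3) ℂ)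

theorem isHomogeneousIdeal_span_range {κ : Type*} {F : κ → S} {e : ℕ}
    (h : ∀ i, (F i).IsHomogeneous e) : IsHomogeneousIdeal (Ideal.span (Set.range F)) := by
  apply Ideal.homogeneous_span
  rintro _ ⟨i, rfl⟩
  exact ⟨e, h i⟩

theorem IsHomogeneousIdeal.pow {I : Ideal S} (hI : IsHomogeneousIdeal I) (n : ℕ) :
    IsHomogeneousIdeal (I ^ n) := by
  induction n with
  | zero =>
    rw [pow_zero, Ideal.one_eq_top]
    exact Ideal.IsHomogeneous.top _
  | succ n ih =>
    rw [pow_succ]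
    exact ih.mul hI

theorem homogeneousComponent_succ_mul_linear {ℓ : S} (hℓ : ℓ.IsHomogeneous 1) (h : S) (e : ℕ) :
    homogeneousComponent (e + 1) (ℓ * h) = ℓ * homogeneousComponent e h := by
  rw [mul_comm, homogeneousComponent_mul_of_isHomogeneous hℓ (by omega), Nat.add_sub_cancel,
    mul_comm]

theorem homogeneousComponent_zero_mul_linear {ℓ : S} (hℓ : ℓ.IsHomogeneous 1) (h : S) :
    homogeneousComponent 0 (ℓ * h) = 0 := by
  have h0 : coeff 0 ℓ = 0 := hℓ.coeff_eq_zero (by simp)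
  rw [homogeneousComponent_zero, ← constantCoeff_eq, map_mul, constantCoeff_eq, h0, zero_mul, C_0]

theorem form_le_pow_idealOfVars {k n : ℕ} (h : n ≤ k) {s : S} (hs : s ∈ Form k) :
    s ∈ idealOfVars (Fin 3) ℂ ^ n := by
  rw [mem_pow_idealOfVars_iff']
  intro m hm
  exact IsHomogeneous.coeff_eq_zero hs (by omega)

section Dehomogenization

variable {I : Ideal S} {ℓ : S} {n : ℕ}

theorem exists_form_sub_mul_mem (hI : IsHomogeneousIdeal I) (hℓ : ℓ.IsHomogeneous 1)
    (hn : idealOfVars (Fin 3) ℂ ^ n ≤ I ⊔ Ideal.span {ℓ}) {k : ℕ} (hk : n ≤ k + 1) {s : S}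
    (hs : s ∈ Form (k + 1)) : ∃ t ∈ Form k, s - ℓ * t ∈ I := by
  obtain ⟨i, hi, b, hb, rfl⟩ := Submodule.mem_sup.mp (hn (form_le_pow_idealOfVars hk hs))
  obtain ⟨t, rfl⟩ := Ideal.mem_span_singleton.mp hb
  refine ⟨homogeneousComponent k t, homogeneousComponent_isHomogeneous _ _, ?_⟩
  rw [← homogeneousComponent_eq_self hs, map_add, homogeneousComponent_succ_mul_linear hℓ,
    add_sub_cancel_right]
  exact homogeneousComponent_mem_of_mem hI hi _

theorem hilb_piece_succ (hI : IsHomogeneousIdeal I) (hℓ : ℓ.IsHomogeneous 1)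
    (hn : idealOfVars (Fin 3) ℂ ^ n ≤ I ⊔ Ideal.span {ℓ}) {k : ℕ} (hk : n ≤ k + 1) :
    (Form (k + 1)).map (Ideal.Quotient.mkₐ ℂ I).toLinearMap
      = ((Form k).map (Ideal.Quotient.mkₐ ℂ I).toLinearMap).map
        (LinearMap.mulLeft ℂ (Ideal.Quotient.mkₐ ℂ I ℓ)) := by
  apply le_antisymm
  · rintro _ ⟨s, hs, rfl⟩
    obtain ⟨t, ht, hst⟩ := exists_form_sub_mul_mem hI hℓ hn hk hs
    refine ⟨_, ⟨t, ht, rfl⟩, ?_⟩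
    have := Ideal.Quotient.eq.mpr hst
    simpa using this.symm
  · rintro _ ⟨_, ⟨t, ht, rfl⟩, rfl⟩
    refine ⟨ℓ * t, ?_, by simp⟩
    rw [add_comm]
    exact hℓ.mul ht

/-- Multiplication by `ℓ` maps each large graded piece of `S / I` onto the next, so the dimensions
are nonincreasing and eventually constant; from there on the surjections are injective. -/
theorem exists_forall_mem_of_mul_mem (hI : IsHomogeneousIdeal I) (hℓ : ℓ.IsHomogeneous 1)
    (hn : idealOfVars (Fin 3) ℂ ^ n ≤ I ⊔ Ideal.span {ℓ}) :
    ∃ k₁, n ≤ k₁ ∧ ∀ k, k₁ ≤ k → ∀ t ∈ Form k, ℓ * t ∈ I → t ∈ I := by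
  have hanti : ∀ k, n ≤ k → hilb I (k + 1) ≤ hilb I k := by
    intro k hk
    rw [hilb, hilb, hilb_piece_succ hI hℓ hn (by omega)]
    exact Submodule.finrank_map_le _ _
  obtain ⟨k₁, hk₁, hmin⟩ : ∃ k₁, n ≤ k₁ ∧ ∀ k, n ≤ k → hilb I k₁ ≤ hilb I k := by
    have hne : (hilb I '' Set.Ici n).Nonempty := ⟨_, n, Set.self_mem_Ici, rfl⟩
    obtain ⟨k₁, hk₁, he⟩ := Nat.sInf_mem hne
    exact ⟨k₁, hk₁, fun k hk => he ▸ Nat.sInf_le ⟨k, hk, rfl⟩⟩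
  have hconst : ∀ j, hilb I (k₁ + j) = hilb I k₁ := by
    intro j
    induction j with
    | zero => rfl
    | succ j ih =>
      refine le_antisymm ?_ (hmin _ (by omega))
      rw [← ih]
      exact hanti (k₁ + j) (by omega)
  refine ⟨k₁, hk₁, fun k hk t ht hlt => ?_⟩
  obtain ⟨j, rfl⟩ := Nat.exists_eq_add_of_le hk
  have h1 := finrank_map_add_finrank_inf_ker (LinearMap.mulLeft ℂ (Ideal.Quotient.mkₐ ℂ I ℓ))
    ((Form (k₁ + j)).map (Ideal.Quotient.mkₐ ℂ I).toLinearMap)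
  rw [← hilb_piece_succ hI hℓ hn (by omega)] at h1
  have h2 : hilb I (k₁ + j + 1) = hilb I (k₁ + j) := by
    rw [hconst j, add_assoc, hconst]
  rw [hilb, hilb] at h2
  rw [h2, Nat.add_eq_left] at h1
  have hfin : FiniteDimensional ℂ
      ((Form (k₁ + j)).map (Ideal.Quotient.mkₐ ℂ I).toLinearMap ⊓
        LinearMap.ker (LinearMap.mulLeft ℂ (Ideal.Quotient.mkₐ ℂ I ℓ)) :
        Submodule ℂ (S ⧸ I)) := Submodule.finiteDimensional_of_le inf_le_left
  have h3 := Submodule.finrank_eq_zero.mp h1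
  have h4 : Ideal.Quotient.mkₐ ℂ I t ∈ ((Form (k₁ + j)).map
      (Ideal.Quotient.mkₐ ℂ I).toLinearMap ⊓
        LinearMap.ker (LinearMap.mulLeft ℂ (Ideal.Quotient.mkₐ ℂ I ℓ)) :
        Submodule ℂ (S ⧸ I)) := by
    refine ⟨⟨t, ht, rfl⟩, ?_⟩
    change Ideal.Quotient.mkₐ ℂ I ℓ * Ideal.Quotient.mkₐ ℂ I t = 0
    rw [← map_mul]
    exact Ideal.Quotient.eq_zero_iff_mem.mpr hlt
  rw [h3, Submodule.mem_bot] at h4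
  exact Ideal.Quotient.eq_zero_iff_mem.mp h4

/-- Write `s = i + (ℓ - c) h` and compare components. Below degree `k` the components of `h` lie in
`I` by upward induction, dividing by `c`; from degree `k` on by downward induction, cancelling `ℓ`.
-/
theorem mem_of_form_mem_sup (hI : IsHomogeneousIdeal I) (hℓ : ℓ.IsHomogeneous 1) {c : ℂ}
    (hc : c ≠ 0) {k₁ : ℕ} (hinj : ∀ k, k₁ ≤ k → ∀ t ∈ Form k, ℓ * t ∈ I → t ∈ I) {k : ℕ}
    (hk : k₁ ≤ k) {s : S} (hs : s ∈ Form k) (hsA : s ∈ I ⊔ Ideal.span {ℓ - C c}) : s ∈ I := by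
  obtain ⟨i, hi, b, hb, he⟩ := Submodule.mem_sup.mp hsA
  obtain ⟨h, rfl⟩ := Ideal.mem_span_singleton.mp hb
  have hcancel : ∀ p : S, C c * p ∈ I → p ∈ I := by
    intro p hp
    have := I.mul_mem_left (C c⁻¹) hp
    rwa [← mul_assoc, ← C_mul, inv_mul_cancel₀ hc, C_1, one_mul] at this
  have hcomp : ∀ e, homogeneousComponent e s = homogeneousComponent e i
      + homogeneousComponent e (ℓ * h) - C c * homogeneousComponent e h := by
    intro e
    rw [← he, map_add, sub_mul, map_sub, homogeneousComponent_C_mul]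
    ring
  have hne : ∀ e, e ≠ k → homogeneousComponent e s = 0 := by
    intro e hek
    rw [homogeneousComponent_of_mem hs, if_neg hek]
  have hi' : ∀ e, homogeneousComponent e i ∈ I := homogeneousComponent_mem_of_mem hI hi
  have hlow : ∀ e, e < k → homogeneousComponent e h ∈ I := by
    intro e
    induction e with
    | zero =>
      intro hek
      have h1 := hcomp 0
      rw [hne 0 hek.ne, homogeneousComponent_zero_mul_linear hℓ] at h1
      apply hcancel
      rw [show C c * homogeneousComponent 0 h = homogeneousComponent 0 i by
        linear_combination h1]
      exact hi' 0
    | succ e ih =>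
      intro hek
      have h1 := hcomp (e + 1)
      rw [hne _ hek.ne, homogeneousComponent_succ_mul_linear hℓ] at h1
      apply hcancel
      rw [show C c * homogeneousComponent (e + 1) h = homogeneousComponent (e + 1) i
        + ℓ * homogeneousComponent e h by linear_combination h1]
      exact I.add_mem (hi' _) (I.mul_mem_left _ (ih (by omega)))
  have hhigh : ∀ j e, k ≤ e → h.totalDegree < e + j → homogeneousComponent e h ∈ I := by
    intro j
    induction j with
    | zero =>
      intro e _ hj
      rw [homogeneousComponent_eq_zero e h hj]
      exact I.zero_mem
    | succ j ih =>
      intro e hke hj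
      have h1 := hcomp (e + 1)
      rw [hne _ (by omega), homogeneousComponent_succ_mul_linear hℓ] at h1
      apply hinj e (by omega) _ (homogeneousComponent_isHomogeneous _ _)
      rw [show ℓ * homogeneousComponent e h = C c * homogeneousComponent (e + 1) h
        - homogeneousComponent (e + 1) i by linear_combination -h1]
      exact I.sub_mem (I.mul_mem_left _ (ih _ (by omega) (by omega))) (hi' _)
  have hh : h ∈ I := by
    rw [mem_iff_homogeneousComponent_mem hI]
    intro e
    rcases lt_or_ge e k with hek | hek
    · exact hlow e hek
    · exact hhigh (h.totalDegree + 1) e hek (by omega)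
  rw [← he]
  exact I.add_mem hi (I.mul_mem_left _ hh)

/-- Modulo `ℓ - c` the degree of a form can be raised by multiplying with `ℓ / c`, and lowered by
writing it as a multiple of `ℓ` modulo `I`. So every class is represented in a single large degree.
-/
theorem exists_form_sub_mem_sup (hI : IsHomogeneousIdeal I) (hℓ : ℓ.IsHomogeneous 1)
    (hn : idealOfVars (Fin 3) ℂ ^ n ≤ I ⊔ Ideal.span {ℓ}) {c : ℂ} (hc : c ≠ 0) {k : ℕ}
    (hk : n ≤ k) (s : S) : ∃ t ∈ Form k, s - t ∈ I ⊔ Ideal.span {ℓ - C c} := by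
  set A := I ⊔ Ideal.span {ℓ - C c} with hA
  have hIA : I ≤ A := le_sup_left
  have hℓA : ℓ - C c ∈ A := Ideal.mem_sup_right (Ideal.mem_span_singleton_self _)
  have hup : ∀ j, ∀ s ∈ Form (k + j), ∃ t ∈ Form k, s - t ∈ A := by
    intro j
    induction j with
    | zero => exact fun s hs => ⟨s, hs, by simp⟩
    | succ j ih =>
      intro s hs
      obtain ⟨s', hs', h1⟩ := exists_form_sub_mul_mem hI hℓ hn (k := k + j) (by omega) hs
      obtain ⟨t, ht, h2⟩ := ih s' hs'
      refine ⟨C c * t, ht.C_mul c, ?_⟩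
      rw [show s - C c * t = (s - ℓ * s') + s' * (ℓ - C c) + C c * (s' - t) by ring]
      exact A.add_mem (A.add_mem (hIA h1) (A.mul_mem_left _ hℓA)) (A.mul_mem_left _ h2)
  have hdown : ∀ j e, e + j = k → ∀ s ∈ Form e, ∃ t ∈ Form k, s - t ∈ A := by
    intro j
    induction j with
    | zero =>
      rintro e rfl s hs
      exact ⟨s, hs, by simp⟩
    | succ j ih =>
      intro e he s hs
      have hs' : C c⁻¹ * (s * ℓ) ∈ Form (e + 1) := (hs.mul hℓ).C_mul _
      obtain ⟨t, ht, h1⟩ := ih (e + 1) (by omega) _ hs'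
      refine ⟨t, ht, ?_⟩
      have hcc : (C c⁻¹ : S) * C c = 1 := by rw [← C_mul, inv_mul_cancel₀ hc, C_1]
      rw [show s - t = (C c⁻¹ * (s * ℓ) - t) + -(C c⁻¹ * s) * (ℓ - C c) by
        linear_combination -s * hcc]
      exact A.add_mem h1 (A.mul_mem_left _ hℓA)
  have hform : ∀ e, ∀ s ∈ Form e, ∃ t ∈ Form k, s - t ∈ A := by
    intro e s hs
    rcases le_total e k with h | h
    · exact hdown (k - e) e (by omega) s hs
    · obtain ⟨j, rfl⟩ := Nat.exists_eq_add_of_le h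
      exact hup j s hs
  choose t ht hst using fun e => hform e _ (homogeneousComponent_isHomogeneous e s)
  refine ⟨∑ e ∈ Finset.range (s.totalDegree + 1), t e, Submodule.sum_mem _ fun e _ => ht e, ?_⟩
  nth_rw 1 [← sum_homogeneousComponent s]
  rw [← Finset.sum_sub_distrib]
  exact A.sum_mem fun e _ => hst e

/-- In large degrees, the Hilbert function of `S / I` is the dimension of the affine coordinate
ring obtained by setting a linear form `ℓ` to a nonzero constant, if `ℓ` has no zero on the
projective scheme defined by `I`. -/
theorem hilb_eq_finrank_of_pow_le (hI : IsHomogeneousIdeal I) (hℓ : ℓ.IsHomogeneous 1)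
    (hn : idealOfVars (Fin 3) ℂ ^ n ≤ I ⊔ Ideal.span {ℓ}) {c : ℂ} (hc : c ≠ 0) :
    Module.Finite ℂ (S ⧸ (I ⊔ Ideal.span {ℓ - C c})) ∧
    ∃ k₁, ∀ k, k₁ ≤ k → hilb I k = finrank ℂ (S ⧸ (I ⊔ Ideal.span {ℓ - C c})) := by
  obtain ⟨k₁, hnk, hinj⟩ := exists_forall_mem_of_mul_mem hI hℓ hn
  set A := I ⊔ Ideal.span {ℓ - C c} with hA
  have htop : ∀ k, n ≤ k → (Form k).map (Ideal.Quotient.mkₐ ℂ A).toLinearMap = ⊤ := by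
    intro k hk
    rw [eq_top_iff]
    rintro x -
    obtain ⟨s, rfl⟩ := Ideal.Quotient.mk_surjective x
    obtain ⟨t, ht, hst⟩ := exists_form_sub_mem_sup hI hℓ hn hc hk s
    exact ⟨t, ht, (Ideal.Quotient.eq.mpr hst).symm⟩
  refine ⟨?_, k₁, fun k hk => ?_⟩
  · rw [Module.finite_def, ← htop n le_rfl]
    exact ((homogeneousSubmodule_fg (Fin 3) ℂ n).map _)
  · have h1 := hilb_add_finrank_inf A k
    have h2 := hilb_add_finrank_inf I k
    have h3 : (Form k ⊓ A.restrictScalars ℂ : Submodule ℂ S) = Form k ⊓ I.restrictScalars ℂ := by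
      apply le_antisymm
      · exact fun s hs => ⟨hs.1, mem_of_form_mem_sup hI hℓ hc hinj hk hs.1 hs.2⟩
      · exact inf_le_inf_left _ (le_sup_left : I ≤ A)
    have h4 : hilb A k = finrank ℂ (S ⧸ A) := by
      rw [hilb, htop k (by omega), finrank_top]
    rw [h3] at h1
    omega

end Dehomogenization

/-! ### Ideals of points -/

/-- The linear form with coefficients `a`. -/
def linearForm (a : Fin 3 → ℂ) : S := ∑ i, C (a i) * X i

theorem isHomogeneous_linearForm (a : Fin 3 → ℂ) : (linearForm a).IsHomogeneous 1 :=
  IsHomogeneous.sum _ _ _ fun i _ => isHomogeneous_C_mul_X _ i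

theorem eval_linearForm (a v : Fin 3 → ℂ) : eval v (linearForm a) = ∑ i, a i * v i := by
  simp [linearForm]

/-- The homogeneous ideal of the point of the projective plane with coordinates `v`. -/
def projIdeal (v : Fin 3 → ℂ) : Ideal S :=
  Ideal.span (Set.range fun ij : Fin 3 × Fin 3 => C (v ij.1) * X ij.2 - C (v ij.2) * X ij.1)

theorem isHomogeneousIdeal_projIdeal (v : Fin 3 → ℂ) : IsHomogeneousIdeal (projIdeal v) :=
  isHomogeneousIdeal_span_range fun ij =>
    (isHomogeneous_C_mul_X _ ij.2).sub (isHomogeneous_C_mul_X _ ij.1)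

theorem minor_mem_projIdeal (v : Fin 3 → ℂ) (i j : Fin 3) :
    C (v i) * X j - C (v j) * X i ∈ projIdeal v := Ideal.subset_span ⟨(i, j), rfl⟩

theorem projIdeal_smul_le (c : ℂ) (v : Fin 3 → ℂ) : projIdeal (c • v) ≤ projIdeal v := by
  rw [projIdeal, Ideal.span_le]
  rintro _ ⟨⟨i, j⟩, rfl⟩
  have := (projIdeal v).mul_mem_left (C c) (minor_mem_projIdeal v i j)
  simp only [Pi.smul_apply, smul_eq_mul, C_mul, SetLike.mem_coe]
  convert this using 1
  ring

theorem projIdeal_smul {c : ℂ} (hc : c ≠ 0) (v : Fin 3 → ℂ) :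
    projIdeal (c • v) = projIdeal v := by
  refine le_antisymm (projIdeal_smul_le c v) ?_
  have := projIdeal_smul_le c⁻¹ (c • v)
  rwa [smul_smul, inv_mul_cancel₀ hc, one_smul] at this

/-- The maximal ideal of the point of affine three-space with coordinates `v`. -/
def affineIdeal (v : Fin 3 → ℂ) : Ideal S := Ideal.span (Set.range fun i => X i - C (v i))

theorem X_sub_C_mem_affineIdeal (v : Fin 3 → ℂ) (i : Fin 3) : X i - C (v i) ∈ affineIdeal v :=
  Ideal.subset_span ⟨i, rfl⟩

/-- Modulo the minors, `(a · v) X_j = v_j ℓ`. This identity handles both the section `ℓ = 0`, which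
misses the point, and the section `ℓ = a · v`, which meets its line only at `v`. -/
theorem sum_mul_minor (a v : Fin 3 → ℂ) (j : Fin 3) :
    ∑ i, C (a i) * (C (v i) * X j - C (v j) * X i)
      = C (∑ i, a i * v i) * X j - C (v j) * linearForm a := by
  rw [linearForm, map_sum, Finset.sum_mul, Finset.mul_sum, ← Finset.sum_sub_distrib]
  exact Finset.sum_congr rfl fun i _ => by rw [C_mul]; ring

theorem idealOfVars_le_projIdeal_sup {a v : Fin 3 → ℂ} (h : ∑ i, a i * v i ≠ 0) :
    idealOfVars (Fin 3) ℂ ≤ projIdeal v ⊔ Ideal.span {linearForm a} := by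
  rw [idealOfVars, Ideal.span_le]
  rintro _ ⟨j, rfl⟩
  have hcc : (C (∑ i, a i * v i)⁻¹ : S) * C (∑ i, a i * v i) = 1 := by
    rw [← C_mul, inv_mul_cancel₀ h, C_1]
  have h1 : ∑ i, C (a i) * (C (v i) * X j - C (v j) * X i) ∈ projIdeal v :=
    Ideal.sum_mem _ fun i _ => Ideal.mul_mem_left _ _ (minor_mem_projIdeal v i j)
  rw [sum_mul_minor] at h1
  have h2 : (X j : S) = C (∑ i, a i * v i)⁻¹ * (C (∑ i, a i * v i) * X j - C (v j) * linearForm a)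
      + C (∑ i, a i * v i)⁻¹ * C (v j) * linearForm a := by
    linear_combination -X j * hcc
  rw [SetLike.mem_coe, h2]
  exact Ideal.add_mem _ (Ideal.mem_sup_left (Ideal.mul_mem_left _ _ h1))
    (Ideal.mem_sup_right (Ideal.mul_mem_left _ _ (Ideal.mem_span_singleton_self _)))

theorem projIdeal_sup_span {a v : Fin 3 → ℂ} (h : ∑ i, a i * v i ≠ 0) :
    projIdeal v ⊔ Ideal.span {linearForm a - C (∑ i, a i * v i)} = affineIdeal v := by
  apply le_antisymm
  · refine sup_le ?_ ?_
    · rw [projIdeal, Ideal.span_le]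
      rintro _ ⟨⟨i, j⟩, rfl⟩
      have h1 := (affineIdeal v).mul_mem_left (C (v i)) (X_sub_C_mem_affineIdeal v j)
      have h2 := (affineIdeal v).mul_mem_left (C (v j)) (X_sub_C_mem_affineIdeal v i)
      rw [SetLike.mem_coe]
      convert (affineIdeal v).sub_mem h1 h2 using 1
      ring
    · rw [Ideal.span_singleton_le_iff_mem, linearForm, map_sum, ← Finset.sum_sub_distrib]
      refine Ideal.sum_mem _ fun i _ => ?_
      rw [C_mul, ← mul_sub]
      exact Ideal.mul_mem_left _ _ (X_sub_C_mem_affineIdeal v i)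
  · rw [affineIdeal, Ideal.span_le]
    rintro _ ⟨j, rfl⟩
    have hcc : (C (∑ i, a i * v i)⁻¹ : S) * C (∑ i, a i * v i) = 1 := by
      rw [← C_mul, inv_mul_cancel₀ h, C_1]
    have h1 : ∑ i, C (a i) * (C (v i) * X j - C (v j) * X i) ∈ projIdeal v :=
      Ideal.sum_mem _ fun i _ => Ideal.mul_mem_left _ _ (minor_mem_projIdeal v i j)
    rw [sum_mul_minor] at h1
    have h2 : (X j : S) - C (v j) = C (∑ i, a i * v i)⁻¹
          * (C (∑ i, a i * v i) * X j - C (v j) * linearForm a)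
        + C (∑ i, a i * v i)⁻¹ * C (v j) * (linearForm a - C (∑ i, a i * v i)) := by
      linear_combination -(X j - C (v j)) * hcc
    change X j - C (v j) ∈ _
    rw [h2]
    exact Ideal.add_mem _ (Ideal.mem_sup_left (Ideal.mul_mem_left _ _ h1))
      (Ideal.mem_sup_right (Ideal.mul_mem_left _ _ (Ideal.mem_span_singleton_self _)))

theorem sup_pow_le {R : Type*} [CommRing R] (A B : Ideal R) (n : ℕ) :
    (A ⊔ B) ^ n ≤ A ^ n ⊔ B := by
  induction n with
  | zero => simp
  | succ n ih =>
    rw [pow_succ, pow_succ]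
    refine (Ideal.mul_mono ih (le_refl (A ⊔ B))).trans ?_
    rw [Ideal.sup_mul, Ideal.mul_sup]
    have h1 : A ^ n * B ≤ B := Ideal.mul_le_right
    have h2 : B * (A ⊔ B) ≤ B := Ideal.mul_le_left
    exact sup_le (sup_le le_sup_left (h1.trans le_sup_right)) (h2.trans le_sup_right)

theorem projIdeal_pow_sup_span {a v : Fin 3 → ℂ} (h : ∑ i, a i * v i ≠ 0) (n : ℕ) :
    projIdeal v ^ n ⊔ Ideal.span {linearForm a - C (∑ i, a i * v i)}
      = affineIdeal v ^ n ⊔ Ideal.span {linearForm a - C (∑ i, a i * v i)} := by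
  apply le_antisymm
  · refine sup_le_sup_right (Ideal.pow_right_mono ?_ n) _
    rw [← projIdeal_sup_span h]
    exact le_sup_left
  · refine sup_le ?_ le_sup_right
    rw [← projIdeal_sup_span h]
    exact sup_pow_le _ _ n

/-- In large degrees, the Hilbert function of a homogeneous ideal, localized at a point by adding
a power of the ideal of the point, can be computed in every affine chart containing the point. -/
theorem hilb_sup_projIdeal_pow {J : Ideal S} (hJ : IsHomogeneousIdeal J) {a v : Fin 3 → ℂ}
    (h : ∑ i, a i * v i ≠ 0) (n : ℕ) :
    Module.Finite ℂ
      (S ⧸ (J ⊔ affineIdeal v ^ n ⊔ Ideal.span {linearForm a - C (∑ i, a i * v i)})) ∧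
    ∃ k₁, ∀ k, k₁ ≤ k → hilb (J ⊔ projIdeal v ^ n) k
      = finrank ℂ
        (S ⧸ (J ⊔ affineIdeal v ^ n ⊔ Ideal.span {linearForm a - C (∑ i, a i * v i)})) := by
  have hn : idealOfVars (Fin 3) ℂ ^ n ≤ J ⊔ projIdeal v ^ n ⊔ Ideal.span {linearForm a} :=
    (Ideal.pow_right_mono (idealOfVars_le_projIdeal_sup h) n).trans
      ((sup_pow_le _ _ n).trans (sup_le_sup_right le_sup_right _))
  have := hilb_eq_finrank_of_pow_le (hJ.sup ((isHomogeneousIdeal_projIdeal v).pow n))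
    (isHomogeneous_linearForm a) hn h
  rwa [sup_assoc, projIdeal_pow_sup_span h, ← sup_assoc] at this

/-! ### The local Tjurina algebra -/

/-- A surjective linear map with kernel the ideal `I` computes the dimension of the quotient. -/
theorem nonempty_quotient_linearEquiv {A M : Type*} [CommRing A] [Algebra ℂ A] [AddCommGroup M]
    [Module ℂ M] (I : Ideal A) (T : A →ₗ[ℂ] M) (hT : Function.Surjective T)
    (hker : ∀ x, T x = 0 ↔ x ∈ I) : Nonempty ((A ⧸ I) ≃ₗ[ℂ] M) := by
  have h : LinearMap.ker T = I.restrictScalars ℂ := by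
    ext x
    simp [hker]
  exact ⟨(Submodule.Quotient.restrictScalarsEquiv ℂ I).symm.trans
    ((Submodule.quotEquivOfEq _ _ h.symm).trans (T.quotKerEquivOfSurjective hT))⟩

/-- The coordinate ring of the affine plane. -/
abbrev PlaneRing : Type := MvPolynomial (Fin 2) ℂ

theorem exists_mul_sub_one_mem_pow {s : PlaneRing} (hs : s ∉ originIdeal) (n : ℕ) :
    ∃ t, s * t - 1 ∈ originIdeal ^ n := by
  have h0 : constantCoeff s ≠ 0 := hs
  induction n with
  | zero => exact ⟨0, by simp⟩
  | succ n ih =>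
    obtain ⟨t, ht⟩ := ih
    have h1 : s * C (constantCoeff s)⁻¹ - 1 ∈ originIdeal := by
      rw [RingHom.mem_ker]
      simp [h0]
    -- With `c` the inverse of the constant term, this choice `t'` gives `s t' - 1 = -(s t - 1)(s c
    -- - 1)`.
    refine ⟨t + C (constantCoeff s)⁻¹ - s * t * C (constantCoeff s)⁻¹, ?_⟩
    rw [pow_succ]
    have := Ideal.neg_mem_iff _ |>.mpr (Ideal.mul_mem_mul ht h1)
    convert this using 1
    ring

theorem algebraMap_mem_map_origin_iff {I : Ideal PlaneRing} {r : PlaneRing} :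
    algebraMap PlaneRing OriginLocalRing r ∈ I.map (algebraMap PlaneRing OriginLocalRing)
      ↔ ∃ s, s ∉ originIdeal ∧ s * r ∈ I := by
  rw [IsLocalization.algebraMap_mem_map_algebraMap_iff originIdeal.primeCompl]
  rfl

/-- If the local algebra `𝒪 / I` is annihilated by a power of the maximal ideal, then it is
isomorphic to a quotient of the polynomial ring. -/
theorem nonempty_local_quotient_equiv {I : Ideal PlaneRing} {n : ℕ}
    (h : (originIdeal ^ n).map (algebraMap PlaneRing OriginLocalRing)
      ≤ I.map (algebraMap PlaneRing OriginLocalRing)) :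
    Nonempty ((PlaneRing ⧸ (I ⊔ originIdeal ^ n)) ≃ₗ[ℂ]
      (OriginLocalRing ⧸ I.map (algebraMap PlaneRing OriginLocalRing))) := by
  set IR := I.map (algebraMap PlaneRing OriginLocalRing) with hIR
  let T : PlaneRing →ₗ[ℂ] (OriginLocalRing ⧸ IR) :=
    (Ideal.Quotient.mkₐ ℂ IR).toLinearMap ∘ₗ
      (IsScalarTower.toAlgHom ℂ PlaneRing OriginLocalRing).toLinearMap
  have hT : ∀ r, T r = Ideal.Quotient.mk IR (algebraMap PlaneRing OriginLocalRing r) :=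
    fun r => rfl
  refine nonempty_quotient_linearEquiv _ T ?_ ?_
  · intro x
    obtain ⟨y, rfl⟩ := Ideal.Quotient.mk_surjective x
    obtain ⟨⟨a, s⟩, hy⟩ := IsLocalization.surj originIdeal.primeCompl y
    obtain ⟨t, ht⟩ := exists_mul_sub_one_mem_pow (s := s.1) s.2 n
    refine ⟨a * t, ?_⟩
    rw [hT, Ideal.Quotient.eq, map_mul, ← hy]
    have h1 := h (Ideal.mem_map_of_mem (algebraMap PlaneRing OriginLocalRing) ht)
    rw [map_sub, map_mul, map_one] at h1
    have := IR.mul_mem_left y h1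
    convert this using 1
    ring
  · intro r
    rw [hT, Ideal.Quotient.eq_zero_iff_mem, hIR]
    constructor
    · intro hr
      obtain ⟨s, hs, hsr⟩ := algebraMap_mem_map_origin_iff.mp hr
      obtain ⟨t, ht⟩ := exists_mul_sub_one_mem_pow hs n
      rw [show r = t * (s * r) + -r * (s * t - 1) by ring]
      exact Ideal.add_mem _ (Ideal.mem_sup_left (I.mul_mem_left _ hsr))
        (Ideal.mem_sup_right (Ideal.mul_mem_left _ _ ht))
    · intro hr
      have h1 := Ideal.mem_map_of_mem (algebraMap PlaneRing OriginLocalRing) hr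
      rw [Ideal.map_sup] at h1
      exact (sup_le le_rfl h) h1

/-- Equal consecutive lengths mean `m^n ⊆ I + m^(n+1)`; Nakayama's lemma in the local ring gives
`m^n ⊆ I` there. -/
theorem map_pow_le_of_finrank_eq {I : Ideal PlaneRing} {n : ℕ}
    [Module.Finite ℂ (PlaneRing ⧸ (I ⊔ originIdeal ^ (n + 1)))]
    (h : finrank ℂ (PlaneRing ⧸ (I ⊔ originIdeal ^ (n + 1)))
      ≤ finrank ℂ (PlaneRing ⧸ (I ⊔ originIdeal ^ n))) :
    (originIdeal ^ n).map (algebraMap PlaneRing OriginLocalRing)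
      ≤ I.map (algebraMap PlaneRing OriginLocalRing) := by
  have hle : I ⊔ originIdeal ^ (n + 1) ≤ I ⊔ originIdeal ^ n :=
    sup_le_sup_left (Ideal.pow_le_pow_right (Nat.le_succ n)) _
  have hsurj : Function.Surjective (Ideal.Quotient.factorₐ ℂ hle).toLinearMap :=
    Ideal.Quotient.factor_surjective hle
  have hfin : Module.Finite ℂ (PlaneRing ⧸ (I ⊔ originIdeal ^ n)) :=
    Module.Finite.of_surjective _ hsurj
  have heq := le_antisymm h (LinearMap.finrank_le_finrank_of_surjective hsurj)
  have hinj : Function.Injective (Ideal.Quotient.factorₐ ℂ hle).toLinearMap :=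
    (LinearMap.injective_iff_surjective_of_finrank_eq_finrank heq).mpr hsurj
  have hle' : originIdeal ^ n ≤ I ⊔ originIdeal ^ (n + 1) := by
    intro x hx
    rw [← Ideal.Quotient.eq_zero_iff_mem]
    apply hinj
    rw [map_zero]
    exact Ideal.Quotient.eq_zero_iff_mem.mpr (Ideal.mem_sup_right hx)
  have h1 := Ideal.map_mono (f := algebraMap PlaneRing OriginLocalRing) hle'
  rw [Ideal.map_sup, pow_succ', Ideal.map_mul] at h1
  refine Submodule.le_of_le_smul_of_le_jacobson_bot
    (I := originIdeal.map (algebraMap PlaneRing OriginLocalRing)) (IsNoetherian.noetherian _) ?_ h1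
  rw [IsLocalRing.jacobson_eq_maximalIdeal _ bot_ne_top]
  exact (Localization.AtPrime.map_eq_maximalIdeal (I := originIdeal)).le

/-! ### Affine charts -/

section Chart

variable (v : Fin 3 → ℂ) (i : Fin 3)

/-- Restriction of polynomials to the affine plane `x_i = v i`, with coordinates centred at `v`. -/
def chartMap : S →ₐ[ℂ] PlaneRing :=
  aeval (Fin.insertNth (α := fun _ => MvPolynomial (Fin 2) ℂ) i (C (v i))
    (fun k => C (v (i.succAbove k)) + X k))

theorem localEquation_eq (f : S) : localEquation f v i = chartMap v i f := rfl

theorem chartMap_C (c : ℂ) : chartMap v i (C c) = C c := algHom_C _ c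

theorem chartMap_X_self : chartMap v i (X i) = C (v i) := by simp [chartMap]

theorem chartMap_X_succAbove (k : Fin 2) :
    chartMap v i (X (i.succAbove k)) = C (v (i.succAbove k)) + X k := by simp [chartMap]

/-- A section of `chartMap`. -/
def chartSection : PlaneRing →ₐ[ℂ] S :=
  aeval fun k => X (i.succAbove k) - C (v (i.succAbove k))

theorem chartSection_C (c : ℂ) : chartSection v i (C c) = C c := algHom_C _ c

theorem chartMap_chartSection (q : PlaneRing) : chartMap v i (chartSection v i q) = q := by
  have : (chartMap v i).comp (chartSection v i) = AlgHom.id ℂ _ := by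
    ext1 k
    rw [AlgHom.comp_apply, chartSection, aeval_X, map_sub, chartMap_X_succAbove, chartMap_C,
      add_sub_cancel_left, AlgHom.id_apply]
  exact DFunLike.congr_fun this q

theorem chartMap_surjective : Function.Surjective (chartMap v i) :=
  fun q => ⟨_, chartMap_chartSection v i q⟩

theorem ker_chartMap :
    RingHom.ker (chartMap v i) = Ideal.span {X i - C (v i)} := by
  apply le_antisymm
  · intro p hp
    have h : ((Ideal.Quotient.mkₐ ℂ (Ideal.span {X i - C (v i)})).comp
        ((chartSection v i).comp (chartMap v i)))
        = Ideal.Quotient.mkₐ ℂ (Ideal.span {X i - C (v i)}) := by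
      ext1 j
      rcases Fin.eq_self_or_eq_succAbove i j with rfl | ⟨k, rfl⟩
      · simp only [AlgHom.comp_apply, chartMap_X_self, chartSection_C]
        symm
        exact Ideal.Quotient.eq.mpr (Ideal.mem_span_singleton_self _)
      · simp only [AlgHom.comp_apply, chartMap_X_succAbove]
        rw [map_add, chartSection_C]
        congr 1
        simp [chartSection]
    have h1 := DFunLike.congr_fun h p
    simp only [AlgHom.comp_apply] at h1
    rw [RingHom.mem_ker] at hp
    rw [show chartMap v i p = 0 from hp, map_zero, map_zero] at h1
    exact Ideal.Quotient.eq_zero_iff_mem.mp h1.symm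
  · rw [Ideal.span_singleton_le_iff_mem, RingHom.mem_ker, map_sub, chartMap_X_self,
      chartMap_C, sub_self]

theorem nonempty_chart_quotient_equiv (A : Ideal S) :
    Nonempty ((S ⧸ (A ⊔ Ideal.span {X i - C (v i)})) ≃ₗ[ℂ]
      (PlaneRing ⧸ A.map (chartMap v i))) := by
  let T : S →ₗ[ℂ] (PlaneRing ⧸ A.map (chartMap v i)) :=
    (Ideal.Quotient.mkₐ ℂ (A.map (chartMap v i))).toLinearMap ∘ₗ (chartMap v i).toLinearMap
  refine nonempty_quotient_linearEquiv _ T ?_ ?_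
  · exact (Ideal.Quotient.mk_surjective).comp (chartMap_surjective v i)
  · intro x
    have h1 : T x = 0 ↔ chartMap v i x ∈ A.map (chartMap v i) :=
      Ideal.Quotient.eq_zero_iff_mem
    rw [h1, ← ker_chartMap, ← Ideal.mem_comap,
      Ideal.comap_map_of_surjective' _ (chartMap_surjective v i)]

theorem constantCoeff_chartMap (p : S) : constantCoeff (chartMap v i p) = eval v p := by
  have : (constantCoeff : PlaneRing →+* ℂ).comp (chartMap v i : S →+* PlaneRing)
      = (eval v : S →+* ℂ) := by
    apply MvPolynomial.ringHom_ext
    · intro c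
      simp only [RingHom.comp_apply, RingHom.coe_coe, eval_C]
      rw [chartMap_C, constantCoeff_C]
    · intro j
      simp only [RingHom.comp_apply, RingHom.coe_coe, eval_X]
      rcases Fin.eq_self_or_eq_succAbove i j with rfl | ⟨k, rfl⟩
      · rw [chartMap_X_self, constantCoeff_C]
      · rw [chartMap_X_succAbove, map_add, constantCoeff_C, constantCoeff_X, add_zero]
  exact DFunLike.congr_fun this p

theorem originIdeal_eq_idealOfVars : originIdeal = idealOfVars (Fin 2) ℂ := by
  ext p
  rw [← pow_one (idealOfVars (Fin 2) ℂ), mem_pow_idealOfVars_iff', RingHom.mem_ker,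
    constantCoeff_eq]
  constructor
  · intro h m hm
    have : m = 0 := by
      rw [← Finsupp.degree_eq_zero_iff]
      omega
    rw [this, h]
  · intro h
    exact h 0 (by simp)

theorem map_affineIdeal : (affineIdeal v).map (chartMap v i) = originIdeal := by
  rw [originIdeal_eq_idealOfVars, affineIdeal, Ideal.map_span]
  apply le_antisymm
  · rw [Ideal.span_le]
    rintro _ ⟨_, ⟨j, rfl⟩, rfl⟩
    rw [← originIdeal_eq_idealOfVars, SetLike.mem_coe, RingHom.mem_ker,
      constantCoeff_chartMap]
    simp
  · rw [idealOfVars, Ideal.span_le]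
    rintro _ ⟨k, rfl⟩
    refine Ideal.subset_span ⟨_, ⟨i.succAbove k, rfl⟩, ?_⟩
    rw [map_sub, chartMap_X_succAbove, chartMap_C, add_sub_cancel_left]

theorem pderiv_chartMap (k : Fin 2) (p : S) :
    pderiv k (chartMap v i p) = chartMap v i (pderiv (i.succAbove k) p) := by
  induction p using MvPolynomial.induction_on with
  | C a =>
    rw [chartMap_C, pderiv_C, pderiv_C, map_zero]
  | add p q hp hq => simp only [map_add, hp, hq]
  | mul_X p j hp =>
    rw [map_mul, pderiv_mul, pderiv_mul, hp, map_add, map_mul, map_mul]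
    congr 2
    rcases Fin.eq_self_or_eq_succAbove i j with rfl | ⟨l, rfl⟩
    · rw [chartMap_X_self, pderiv_C, pderiv_X_of_ne (Fin.succAbove_ne j k).symm, map_zero]
    · rw [chartMap_X_succAbove, map_add, pderiv_C, zero_add]
      by_cases h : l = k
      · subst h
        rw [pderiv_X_self, pderiv_X_self, map_one]
      · rw [pderiv_X_of_ne h, pderiv_X_of_ne
          (fun h' => h (Fin.succAbove_right_injective h')), map_zero]

/-- The Jacobian ideal of a polynomial. -/
def jacobianIdeal (f : S) : Ideal S := Ideal.span (Set.range fun j => pderiv j f)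

variable {v i}

/-- By Euler's identity, the Tjurina ideal is the restriction of the Jacobian ideal to a chart. -/
theorem span_localEquation_eq {f : S} {d : ℕ} (hf : f.IsHomogeneous d) (hd : 1 ≤ d)
    (hv : v i ≠ 0) :
    Ideal.span {localEquation f v i, pderiv 0 (localEquation f v i),
      pderiv 1 (localEquation f v i)} = (jacobianIdeal f).map (chartMap v i) := by
  have hE := congrArg (chartMap v i) hf.sum_X_mul_pderiv
  rw [Fin.sum_univ_succAbove _ i, map_add, map_sum, map_mul, chartMap_X_self, map_nsmul,
    nsmul_eq_mul] at hE
  simp only [map_mul, ← pderiv_chartMap] at hE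
  have hmem : ∀ j, chartMap v i (pderiv j f) ∈ (jacobianIdeal f).map (chartMap v i) := fun j =>
    Ideal.mem_map_of_mem _ (Ideal.subset_span ⟨j, rfl⟩)
  have hd0 : (d : ℂ) ≠ 0 := by exact_mod_cast (by omega : d ≠ 0)
  have hcd : (C (d : ℂ)⁻¹ : PlaneRing) * (d : PlaneRing) = 1 := by
    rw [show (d : PlaneRing) = C (d : ℂ) by simp, ← C_mul, inv_mul_cancel₀ hd0, C_1]
  have hcv : (C (v i)⁻¹ : PlaneRing) * C (v i) = 1 := by
    rw [← C_mul, inv_mul_cancel₀ hv, C_1]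
  rw [localEquation_eq]
  apply le_antisymm
  · rw [Ideal.span_le]
    have hk : ∀ k, pderiv k (chartMap v i f) ∈ (jacobianIdeal f).map (chartMap v i) := by
      intro k
      rw [pderiv_chartMap]
      exact hmem _
    rintro _ (rfl | rfl | rfl)
    · rw [SetLike.mem_coe, ← one_mul (chartMap v i f), ← hcd, mul_assoc, ← hE]
      exact Ideal.mul_mem_left _ _ (Ideal.add_mem _ (Ideal.mul_mem_left _ _ (hmem i))
        (Ideal.sum_mem _ fun k _ => Ideal.mul_mem_left _ _ (hk k)))
    · exact hk 0
    · exact hk 1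
  · rw [jacobianIdeal, Ideal.map_span, Ideal.span_le]
    have hk : ∀ k, pderiv k (chartMap v i f) ∈ Ideal.span {chartMap v i f,
        pderiv 0 (chartMap v i f), pderiv 1 (chartMap v i f)} := by
      intro k
      apply Ideal.subset_span
      fin_cases k <;> simp
    rintro _ ⟨_, ⟨j, rfl⟩, rfl⟩
    rcases Fin.eq_self_or_eq_succAbove i j with rfl | ⟨k, rfl⟩
    · change chartMap v j (pderiv j f) ∈ _
      rw [← one_mul (chartMap v j (pderiv j f)), ← hcv, mul_assoc, eq_sub_of_add_eq hE]
      exact Ideal.mul_mem_left _ _ (Ideal.sub_mem _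
        (Ideal.mul_mem_left _ _ (Ideal.subset_span (by simp)))
        (Ideal.sum_mem _ fun k _ => Ideal.mul_mem_left _ _ (hk k)))
    · change chartMap v i (pderiv (i.succAbove k) f) ∈ _
      rw [← pderiv_chartMap]
      exact hk k

theorem linearForm_single (i : Fin 3) : linearForm (Pi.single i 1) = X i := by
  rw [linearForm, Finset.sum_eq_single i]
  · simp
  · intro j _ hj
    simp [hj]
  · simp

theorem finrank_chart_quotient {J : Ideal S}
    (hJ : IsHomogeneousIdeal J) (hv : v i ≠ 0) (n : ℕ) :
    Module.Finite ℂ (PlaneRing ⧸ (J.map (chartMap v i) ⊔ originIdeal ^ n)) ∧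
    ∃ k₁, ∀ k, k₁ ≤ k → hilb (J ⊔ projIdeal v ^ n) k
      = finrank ℂ (PlaneRing ⧸ (J.map (chartMap v i) ⊔ originIdeal ^ n)) := by
  have hsum : ∑ j, (Pi.single i 1 : Fin 3 → ℂ) j * v j = v i := by
    simp [Pi.single_apply]
  obtain ⟨hfin, k₁, hk₁⟩ := hilb_sup_projIdeal_pow hJ (a := Pi.single i 1) (v := v)
    (by rwa [hsum]) n
  rw [hsum, linearForm_single] at hfin hk₁
  obtain ⟨e⟩ := nonempty_chart_quotient_equiv v i (J ⊔ affineIdeal v ^ n)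
  rw [Ideal.map_sup, Ideal.map_pow, map_affineIdeal] at e
  refine ⟨Module.Finite.equiv e, k₁, fun k hk => ?_⟩
  rw [hk₁ k hk, e.finrank_eq]

/-- The Tjurina number at a point as a value of a Hilbert function. -/
theorem exists_hilb_eq_tjurinaAtOrigin {f : S} {d : ℕ} (hf : f.IsHomogeneous d) (hd : 1 ≤ d)
    (hv : v i ≠ 0) {B k₀ : ℕ} (hB : ∀ k, k₀ ≤ k → hilb (jacobianIdeal f) k ≤ B) :
    ∃ n₀, ∀ n, n₀ ≤ n → ∃ k₁, ∀ k, k₁ ≤ k →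
      hilb (jacobianIdeal f ⊔ projIdeal v ^ n) k = tjurinaAtOrigin (localEquation f v i) := by
  have hJ : IsHomogeneousIdeal (jacobianIdeal f) :=
    isHomogeneousIdeal_span_range fun j => hf.pderiv
  set I := (jacobianIdeal f).map (chartMap v i) with hI
  have hbound : ∀ n, finrank ℂ (PlaneRing ⧸ (I ⊔ originIdeal ^ n)) ≤ B := by
    intro n
    obtain ⟨-, k₁, hk₁⟩ := finrank_chart_quotient hJ hv n
    rw [← hk₁ (max k₀ k₁) (le_max_right _ _)]
    exact (hilb_anti le_sup_left _).trans (hB _ (le_max_left _ _))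
  -- These lengths are bounded by `B`, so they cannot increase strictly forever. At the first
  -- failure Nakayama's lemma shows that the local Tjurina ideal contains a power of the maximal
  -- ideal.
  have hstab : ∃ n, finrank ℂ (PlaneRing ⧸ (I ⊔ originIdeal ^ (n + 1)))
      ≤ finrank ℂ (PlaneRing ⧸ (I ⊔ originIdeal ^ n)) := by
    by_contra! hlt
    have : ∀ n, n ≤ finrank ℂ (PlaneRing ⧸ (I ⊔ originIdeal ^ n)) := by
      intro n
      induction n with
      | zero => exact Nat.zero_le _
      | succ n ih => exact lt_of_le_of_lt ih (hlt n)
    have := (this (B + 1)).trans (hbound (B + 1))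
    omega
  obtain ⟨n₀, hn₀⟩ := hstab
  have hfin := (finrank_chart_quotient hJ hv (n₀ + 1)).1
  have hle := map_pow_le_of_finrank_eq hn₀
  refine ⟨n₀, fun n hn => ?_⟩
  obtain ⟨-, k₁, hk₁⟩ := finrank_chart_quotient hJ hv n
  refine ⟨k₁, fun k hk => ?_⟩
  obtain ⟨e⟩ := nonempty_local_quotient_equiv
    ((Ideal.map_mono (Ideal.pow_le_pow_right hn)).trans hle)
  rw [hk₁ k hk, e.finrank_eq, tjurinaAtOrigin, tjurinaIdeal, span_localEquation_eq hf hd hv]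

theorem tjurinaAtOrigin_eq_zero {f : S} {d : ℕ} (hf : f.IsHomogeneous d) (hd : 1 ≤ d)
    (hv : v i ≠ 0) {j : Fin 3} (hj : eval v (pderiv j f) ≠ 0) :
    tjurinaAtOrigin (localEquation f v i) = 0 := by
  rw [tjurinaAtOrigin, tjurinaIdeal, span_localEquation_eq hf hd hv]
  have htop : ((jacobianIdeal f).map (chartMap v i)).map
      (algebraMap PlaneRing OriginLocalRing) = ⊤ := by
    rw [Ideal.eq_top_iff_one, ← map_one (algebraMap PlaneRing OriginLocalRing),
      algebraMap_mem_map_origin_iff]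
    refine ⟨chartMap v i (pderiv j f), ?_, ?_⟩
    · rw [RingHom.mem_ker, constantCoeff_chartMap]
      exact hj
    · rw [mul_one]
      exact Ideal.mem_map_of_mem _ (Ideal.subset_span ⟨j, rfl⟩)
  rw [htop]
  have := Ideal.Quotient.subsingleton_iff.mpr (rfl : (⊤ : Ideal OriginLocalRing) = ⊤)
  exact finrank_zero_of_subsingleton

end Chart

/-! ### The total Tjurina number as a value of the Hilbert function -/

theorem eval_smul_of_isHomogeneous {p : S} {e : ℕ} (hp : p.IsHomogeneous e) (c : ℂ)
    (v : Fin 3 → ℂ) : eval (c • v) p = c ^ e * eval v p := by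
  rw [eval_eq', eval_eq', Finset.mul_sum]
  refine Finset.sum_congr rfl fun m hm => ?_
  have hdeg : ∑ i, m i = e := by
    rw [← Finsupp.degree_eq_sum]
    by_contra h
    exact MvPolynomial.mem_support_iff.mp hm (hp.coeff_eq_zero h)
  simp only [Pi.smul_apply, smul_eq_mul, mul_pow, Finset.prod_mul_distrib,
    Finset.prod_pow_eq_pow_sum, hdeg]
  ring

theorem eval_eq_zero_of_mem_affineIdeal {w : Fin 3 → ℂ} {g : S} (hg : g ∈ affineIdeal w) :
    eval w g = 0 := by
  have : affineIdeal w ≤ RingHom.ker (eval w : S →+* ℂ) := by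
    rw [affineIdeal, Ideal.span_le]
    rintro _ ⟨i, rfl⟩
    simp [RingHom.mem_ker]
  exact this hg

theorem isCoprime_affineIdeal {w w' : Fin 3 → ℂ} (h : w ≠ w') :
    IsCoprime (affineIdeal w) (affineIdeal w') := by
  obtain ⟨i, hi⟩ := Function.ne_iff.mp h
  rw [Ideal.isCoprime_iff_sup_eq]
  have h1 : C (w' i - w i) ∈ affineIdeal w ⊔ affineIdeal w' := by
    have := Ideal.sub_mem (affineIdeal w ⊔ affineIdeal w')
      (Ideal.mem_sup_left (X_sub_C_mem_affineIdeal w i))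
      (Ideal.mem_sup_right (X_sub_C_mem_affineIdeal w' i))
    rw [C_sub]
    convert this using 1
    ring
  exact Ideal.eq_top_of_isUnit_mem _ h1
    ((isUnit_iff_ne_zero.mpr (sub_ne_zero.mpr hi.symm)).map C)

theorem prod_sup_le {ι : Type*} (s : Finset ι) (A : Ideal S) (B : ι → Ideal S) :
    ∏ i ∈ s, (A ⊔ B i) ≤ A ⊔ ∏ i ∈ s, B i := by
  classical
  induction s using Finset.induction with
  | empty => simp
  | insert a s ha ih =>
    rw [Finset.prod_insert ha, Finset.prod_insert ha]
    refine (Ideal.mul_mono_right ih).trans ?_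
    rw [Ideal.sup_mul, Ideal.mul_sup, Ideal.mul_sup]
    have h1 : A * A ≤ A := Ideal.mul_le_left
    have h2 : A * (∏ i ∈ s, B i) ≤ A := Ideal.mul_le_left
    have h3 : B a * A ≤ A := Ideal.mul_le_right
    exact sup_le (sup_le (h1.trans le_sup_left) (h2.trans le_sup_left))
      (sup_le (h3.trans le_sup_left) le_sup_right)

/-- The complex projective plane. -/
abbrev ProjectivePlane : Type := Projectivization ℂ (Fin 3 → ℂ)

theorem projectivePlane_eq_of_minors {p q : ProjectivePlane}
    (h : ∀ i j, q.rep i * p.rep j = q.rep j * p.rep i) : p = q := by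
  obtain ⟨i, hi⟩ := Function.ne_iff.mp q.rep_nonzero
  have hi' : q.rep i ≠ 0 := hi
  rw [← p.mk_rep, ← q.mk_rep, Projectivization.mk_eq_mk_iff']
  refine ⟨p.rep i / q.rep i, ?_⟩
  ext j
  rw [Pi.smul_apply, smul_eq_mul, div_mul_eq_mul_div, div_eq_iff hi']
  linear_combination -h i j

theorem exists_linearForm_separating {p q : ProjectivePlane} (h : p ≠ q) :
    ∃ a, eval q.rep (linearForm a) = 0 ∧ eval p.rep (linearForm a) ≠ 0 := by
  by_contra! hall
  apply h
  apply projectivePlane_eq_of_minors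
  intro i j
  have key : ∀ v : Fin 3 → ℂ, eval v (linearForm (Pi.single j (q.rep i) - Pi.single i (q.rep j)))
      = q.rep i * v j - q.rep j * v i := by
    intro v
    rw [eval_linearForm]
    simp [sub_mul, Finset.sum_sub_distrib, Pi.single_apply]
  have := hall (Pi.single j (q.rep i) - Pi.single i (q.rep j)) (by rw [key]; ring)
  rw [key] at this
  exact sub_eq_zero.mp this

/-- Evaluation at `k + 1` points is onto in degree `k`: for each point, the product of `k` linear
forms, one through each other point and none through this one, separates it. Evaluation factors
through `S / J`. -/
theorem card_le_hilb {J : Ideal S} (T : Finset ProjectivePlane)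
    (hT : ∀ p ∈ T, ∀ g ∈ J, eval p.rep g = 0) {k : ℕ} (hk : T.card = k + 1) :
    T.card ≤ hilb J k := by
  classical
  let E : S →ₗ[ℂ] (T → ℂ) := LinearMap.pi fun p => (aeval p.1.rep : S →ₐ[ℂ] ℂ).toLinearMap
  have hE : ∀ g p, E g p = eval p.1.rep g := fun g p => by
    simp [E, aeval_eq_eval]
  have hsep : ∀ p : T, ∃ L ∈ Form k, ∀ q : T, (eval q.1.rep L = 0 ↔ q ≠ p) := by
    intro p
    have : ∀ q : ProjectivePlane, ∃ a, q ≠ p.1 →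
        eval q.rep (linearForm a) = 0 ∧ eval p.1.rep (linearForm a) ≠ 0 := by
      intro q
      by_cases h : q = p.1
      · exact ⟨0, fun h' => absurd h h'⟩
      · obtain ⟨a, ha⟩ := exists_linearForm_separating (Ne.symm h)
        exact ⟨a, fun _ => ha⟩
    choose a ha using this
    refine ⟨∏ q ∈ T.erase p.1, linearForm (a q), ?_, ?_⟩
    · have := IsHomogeneous.prod (T.erase p.1) (fun q => linearForm (a q)) (fun _ => 1)
        fun q _ => isHomogeneous_linearForm (a q)
      rw [Finset.sum_const, Finset.card_erase_of_mem p.2, hk] at this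
      simpa using this
    · intro q
      rw [map_prod, Finset.prod_eq_zero_iff]
      constructor
      · rintro ⟨q', hq', h0⟩ rfl
        exact (ha q' (Finset.ne_of_mem_erase hq')).2 h0
      · intro hqp
        have hne : q.1 ≠ p.1 := fun h => hqp (Subtype.ext h)
        exact ⟨q.1, Finset.mem_erase.mpr ⟨hne, q.2⟩, (ha q.1 hne).1⟩
  choose L hL hL0 using hsep
  have htop : (Form k).map E = ⊤ := by
    rw [eq_top_iff]
    rintro x -
    refine ⟨∑ p, (x p / eval p.1.rep (L p)) • L p,
      Submodule.sum_mem _ fun p _ => Submodule.smul_mem _ _ (hL p), ?_⟩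
    ext1 q
    rw [hE, map_sum, Finset.sum_eq_single q]
    · rw [smul_eval, div_mul_cancel₀]
      intro h
      exact (hL0 q q).mp h rfl
    · intro p _ hpq
      rw [smul_eval, (hL0 p q).mpr hpq.symm, mul_zero]
    · simp
  have h1 := finrank_map_add_finrank_inf_ker E (Form k)
  rw [htop, finrank_top, Module.finrank_fintype_fun_eq_card, Fintype.card_coe] at h1
  have h2 := hilb_add_finrank_inf J k
  have h3 : finrank ℂ (Form k ⊓ J.restrictScalars ℂ : Submodule ℂ S)
      ≤ finrank ℂ (Form k ⊓ LinearMap.ker E : Submodule ℂ S) := by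
    have : FiniteDimensional ℂ (Form k ⊓ LinearMap.ker E : Submodule ℂ S) :=
      Submodule.finiteDimensional_of_le inf_le_left
    refine Submodule.finrank_mono (inf_le_inf_left _ fun g hg => ?_)
    rw [LinearMap.mem_ker]
    ext1 p
    rw [hE]
    exact hT p.1 p.2 g hg
  rw [formDim] at h2
  omega

theorem exists_linearForm_ne_zero (T : Finset ProjectivePlane) :
    ∃ a : Fin 3 → ℂ, ∀ p ∈ T, ∑ i, a i * p.rep i ≠ 0 := by
  -- The roles of points and coefficients are exchanged: the wanted `a` is a point where none of the
  -- linear forms dual to `T` vanishes.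
  have hne : ∏ p ∈ T, linearForm p.rep ≠ 0 := by
    rw [Finset.prod_ne_zero_iff]
    intro p _ h0
    apply p.rep_nonzero
    ext i
    have := eval_linearForm p.rep (Pi.single i 1)
    rw [h0, map_zero] at this
    simpa [Pi.single_apply] using this.symm
  obtain ⟨a, ha⟩ : ∃ a, eval a (∏ p ∈ T, linearForm p.rep) ≠ 0 := by
    by_contra! h
    exact hne (MvPolynomial.funext fun x => by rw [h x, map_zero])
  rw [map_prod, Finset.prod_ne_zero_iff] at ha
  refine ⟨a, fun p hp => ?_⟩
  have := ha p hp
  rw [eval_linearForm] at this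
  simpa only [mul_comm] using this

/-- The singular points of the curve `f = 0`. -/
def singularPoints (f : S) : Set ProjectivePlane := {p | ∀ j, eval p.rep (pderiv j f) = 0}

theorem eval_eq_zero_of_mem_jacobianIdeal {f : S} {v : Fin 3 → ℂ}
    (h : ∀ j, eval v (pderiv j f) = 0) {g : S} (hg : g ∈ jacobianIdeal f) : eval v g = 0 := by
  have : jacobianIdeal f ≤ RingHom.ker (eval v : S →+* ℂ) := by
    rw [jacobianIdeal, Ideal.span_le]
    rintro _ ⟨j, rfl⟩
    exact h j
  exact this hg

/-- More than `max k₀ B` singular points would impose more than `B` conditions in a degree where `B`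
bounds the Hilbert function. -/
theorem finite_singularPoints {f : S} {B k₀ : ℕ}
    (hB : ∀ k, k₀ ≤ k → hilb (jacobianIdeal f) k ≤ B) : (singularPoints f).Finite := by
  by_contra hinf
  obtain ⟨T, hT, hcard⟩ := (show (singularPoints f).Infinite from hinf).exists_subset_card_eq
    (max k₀ B + 1)
  have h1 := card_le_hilb (J := jacobianIdeal f) T
    (fun p hp g hg => eval_eq_zero_of_mem_jacobianIdeal (hT hp) hg) hcard
  have h2 := hB (max k₀ B) (le_max_left _ _)
  have h3 := le_max_right k₀ B
  omega

theorem mk_mem_singularPoints {f : S} {d : ℕ} (hf : f.IsHomogeneous d) {x : Fin 3 → ℂ}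
    (hx : x ≠ 0) (h : ∀ j, eval x (pderiv j f) = 0) :
    Projectivization.mk ℂ x hx ∈ singularPoints f := by
  obtain ⟨u, hu⟩ := Projectivization.exists_smul_eq_mk_rep ℂ x hx
  intro j
  rw [← hu, show u • x = (u : ℂ) • x from rfl, eval_smul_of_isHomogeneous hf.pderiv, h j, mul_zero]

theorem mem_zeroLocus_jacobianIdeal_sup {f g : S} {x : Fin 3 → ℂ}
    (hx : x ∈ zeroLocus ℂ (jacobianIdeal f ⊔ Ideal.span {g})) :
    (∀ j, eval x (pderiv j f) = 0) ∧ eval x g = 0 := by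
  simp only [mem_zeroLocus_iff, aeval_eq_eval] at hx
  exact ⟨fun j => hx _ (Ideal.mem_sup_left (Ideal.subset_span ⟨j, rfl⟩)),
    hx _ (Ideal.mem_sup_right (Ideal.mem_span_singleton_self _))⟩

/-- For a linear form without zeros on the singular locus, some power of the irrelevant ideal is
contained in the ideal generated by the linear form and the Jacobian ideal. -/
theorem exists_pow_idealOfVars_le {f : S} {d : ℕ} (hf : f.IsHomogeneous d) {a : Fin 3 → ℂ}
    (ha : ∀ p ∈ singularPoints f, ∑ i, a i * p.rep i ≠ 0) :
    ∃ n, idealOfVars (Fin 3) ℂ ^ n ≤ jacobianIdeal f ⊔ Ideal.span {linearForm a} := by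
  apply Ideal.exists_pow_le_of_le_radical_of_fg _ (idealOfVars_fg _ _)
  -- By the Nullstellensatz it suffices that the origin is the only possible common zero of `ℓ` and
  -- the partials.
  rw [← vanishingIdeal_zeroLocus_eq_radical (K := ℂ), idealOfVars, Ideal.span_le]
  rintro _ ⟨i, rfl⟩
  intro x hx
  obtain ⟨h1, h2⟩ := mem_zeroLocus_jacobianIdeal_sup hx
  by_cases hx0 : x = 0
  · simp [hx0]
  exfalso
  obtain ⟨u, hu⟩ := Projectivization.exists_smul_eq_mk_rep ℂ x hx0
  apply ha _ (mk_mem_singularPoints hf hx0 h1)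
  rw [← eval_linearForm, ← hu, show u • x = (u : ℂ) • x from rfl,
    eval_smul_of_isHomogeneous (isHomogeneous_linearForm a), h2, mul_zero]

theorem tjurinaAt_eq_zero {f : S} {d : ℕ} (hf : f.IsHomogeneous d) (hd : 1 ≤ d)
    {p : ProjectivePlane} (hp : p ∉ singularPoints f) : tjurinaAt f p = 0 := by
  obtain ⟨j, hj⟩ := not_forall.mp hp
  exact tjurinaAtOrigin_eq_zero hf hd (Function.ne_iff.mp p.rep_nonzero).choose_spec hj

theorem rep_chartIndex_ne_zero (p : ProjectivePlane) : p.rep (chartIndex p) ≠ 0 :=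
  (Function.ne_iff.mp p.rep_nonzero).choose_spec

/-- The Chinese remainder theorem for a zero-dimensional ideal. -/
theorem finrank_quotient_eq_sum {ι : Type*} [Fintype ι] {A : Ideal S} (w : ι → Fin 3 → ℂ)
    (hw : Function.Injective w) {n : ℕ} (hA : (⨅ p, affineIdeal (w p)) ^ n ≤ A)
    [∀ p, Module.Finite ℂ (S ⧸ (A ⊔ affineIdeal (w p) ^ n))] :
    finrank ℂ (S ⧸ A) = ∑ p, finrank ℂ (S ⧸ (A ⊔ affineIdeal (w p) ^ n)) := by
  classical
  have hcop : Pairwise (Function.onFun IsCoprime fun p => A ⊔ affineIdeal (w p) ^ n) := by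
    intro p q hpq
    have h1 : IsCoprime (affineIdeal (w p) ^ n) (affineIdeal (w q) ^ n) :=
      (isCoprime_affineIdeal (hw.ne hpq)).pow
    rw [Function.onFun, Ideal.isCoprime_iff_sup_eq, eq_top_iff]
    rw [Ideal.isCoprime_iff_sup_eq] at h1
    rw [← h1]
    exact sup_le_sup le_sup_right le_sup_right
  -- For pairwise coprime ideals the intersection is the product, and the product of the `A + m_p^n`
  -- lies in `A + ∏ m_p^n`, hence in `A`.
  have hinf : (⨅ p, (A ⊔ affineIdeal (w p) ^ n)) ≤ A := by
    have h1 := Ideal.prod_eq_iInf_of_pairwise_isCoprime (s := Finset.univ)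
      (J := fun p => A ⊔ affineIdeal (w p) ^ n) (hcop.set_pairwise _)
    simp only [Finset.mem_univ, iInf_pos] at h1
    rw [← h1]
    refine (prod_sup_le _ _ _).trans (sup_le le_rfl ?_)
    rw [Finset.prod_pow]
    refine (Ideal.pow_right_mono ?_ n).trans hA
    refine Ideal.prod_le_inf.trans ?_
    rw [Finset.inf_univ_eq_iInf]
  let T : S →ₗ[ℂ] (∀ p, S ⧸ (A ⊔ affineIdeal (w p) ^ n)) :=
    LinearMap.pi fun p => (Ideal.Quotient.mkₐ ℂ (A ⊔ affineIdeal (w p) ^ n)).toLinearMap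
  obtain ⟨e⟩ := nonempty_quotient_linearEquiv A T
    (by
      intro x
      obtain ⟨r, hr⟩ := Ideal.pi_quotient_surjective hcop x
      exact ⟨r, funext hr⟩)
    (by
      intro x
      have h1 : T x = 0 ↔ ∀ p, x ∈ A ⊔ affineIdeal (w p) ^ n := by
        rw [funext_iff]
        exact forall_congr' fun p => Ideal.Quotient.eq_zero_iff_mem
      rw [h1]
      constructor
      · intro h
        exact hinf (Ideal.mem_iInf.mpr h)
      · exact fun h p => Ideal.mem_sup_left h)
  rw [e.finrank_eq, Module.finrank_pi_fintype]

/-- The Hilbert function of the Jacobian algebra, if bounded, takes the total Tjurina number as its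
value in all large degrees. -/
theorem exists_hilb_eq_totalTjurina {f : S} {d : ℕ} (hf : f.IsHomogeneous d) (hd : 1 ≤ d)
    {B k₀ : ℕ} (hB : ∀ k, k₀ ≤ k → hilb (jacobianIdeal f) k ≤ B) :
    ∃ k₁, ∀ k, k₁ ≤ k → hilb (jacobianIdeal f) k = totalTjurina f := by
  have hJ : IsHomogeneousIdeal (jacobianIdeal f) :=
    isHomogeneousIdeal_span_range fun j => hf.pderiv
  have hfin := finite_singularPoints hB
  set T := hfin.toFinset with hT
  have hmemT : ∀ p, p ∈ T ↔ p ∈ singularPoints f := fun p => hfin.mem_toFinset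
  obtain ⟨a, ha⟩ := exists_linearForm_ne_zero T
  obtain ⟨m, hm⟩ := exists_pow_idealOfVars_le hf (fun p hp => ha p ((hmemT p).mpr hp))
  obtain ⟨-, k₁, hk₁⟩ := hilb_eq_finrank_of_pow_le hJ (isHomogeneous_linearForm a) hm one_ne_zero
  refine ⟨k₁, fun k hk => ?_⟩
  rw [hk₁ k hk]
  set A := jacobianIdeal f ⊔ Ideal.span {linearForm a - C 1} with hA
  -- Each singular point is represented by its unique vector on the affine plane `ℓ = 1`.
  let w : T → Fin 3 → ℂ := fun p => (∑ i, a i * p.1.rep i)⁻¹ • p.1.rep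
  have hc : ∀ p : T, (∑ i, a i * p.1.rep i)⁻¹ ≠ 0 := fun p => inv_ne_zero (ha p.1 p.2)
  have hw1 : ∀ p, ∑ i, a i * w p i = 1 := by
    intro p
    have h1 : ∑ i, a i * w p i = (∑ i, a i * p.1.rep i)⁻¹ * ∑ i, a i * p.1.rep i := by
      rw [Finset.mul_sum]
      refine Finset.sum_congr rfl fun i _ => ?_
      simp only [w, Pi.smul_apply, smul_eq_mul]
      ring
    rw [h1, inv_mul_cancel₀ (ha p.1 p.2)]
  have hwinj : Function.Injective w := by
    intro p q hpq
    apply Subtype.ext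
    rw [← p.1.mk_rep, ← q.1.mk_rep, Projectivization.mk_eq_mk_iff']
    refine ⟨(∑ i, a i * p.1.rep i) * (∑ i, a i * q.1.rep i)⁻¹, ?_⟩
    rw [mul_smul, ← show w q = (∑ i, a i * q.1.rep i)⁻¹ • q.1.rep from rfl, ← hpq,
      smul_inv_smul₀ (ha p.1 p.2)]
  -- Every zero of `A` is one of the vectors `w p`, so the Nullstellensatz puts a power of their
  -- vanishing ideal inside `A`.
  obtain ⟨n₁, hn₁⟩ : ∃ n, (⨅ p, affineIdeal (w p)) ^ n ≤ A := by
    apply Ideal.exists_pow_le_of_le_radical_of_fg _ (IsNoetherian.noetherian _)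
    rw [← vanishingIdeal_zeroLocus_eq_radical (K := ℂ)]
    intro g hg x hx
    obtain ⟨h1, h2⟩ := mem_zeroLocus_jacobianIdeal_sup hx
    rw [map_sub, eval_C, sub_eq_zero] at h2
    have hx0 : x ≠ 0 := by
      rintro rfl
      rw [eval_linearForm] at h2
      simp at h2
    obtain ⟨u, hu⟩ := Projectivization.exists_smul_eq_mk_rep ℂ x hx0
    have hp := (hmemT _).mpr (mk_mem_singularPoints hf hx0 h1)
    have hsum : ∑ i, a i * (Projectivization.mk ℂ x hx0).rep i = u := by
      rw [← eval_linearForm, ← hu, show u • x = (u : ℂ) • x from rfl,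
        eval_smul_of_isHomogeneous (isHomogeneous_linearForm a), h2, pow_one, mul_one]
    have hwx : w ⟨_, hp⟩ = x := by
      simp only [w, hsum]
      rw [← hu, show u • x = (u : ℂ) • x from rfl, inv_smul_smul₀ u.ne_zero]
    have := eval_eq_zero_of_mem_affineIdeal (Ideal.mem_iInf.mp hg ⟨_, hp⟩)
    rw [hwx] at this
    simpa [aeval_eq_eval] using this
  choose n₀ hn₀ using fun p : T =>
    exists_hilb_eq_tjurinaAtOrigin hf hd (rep_chartIndex_ne_zero p.1) hB
  set n := max n₁ (Finset.univ.sup n₀) with hn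
  -- The large-degree Hilbert function of `J + I_p^n` does not refer to a chart. It is computed once
  -- on the plane `ℓ = 1` and once in the standard chart that defines the Tjurina number.
  have hloc : ∀ p : T, Module.Finite ℂ (S ⧸ (A ⊔ affineIdeal (w p) ^ n)) ∧
      finrank ℂ (S ⧸ (A ⊔ affineIdeal (w p) ^ n)) = tjurinaAt f p.1 := by
    intro p
    obtain ⟨l₁, hl₁⟩ := hn₀ p n ((Finset.le_sup (Finset.mem_univ p)).trans (le_max_right _ _))
    obtain ⟨hfin', l₂, hl₂⟩ := hilb_sup_projIdeal_pow hJ (a := a) (v := w p)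
      (by rw [hw1]; exact one_ne_zero) n
    have hAeq : jacobianIdeal f ⊔ affineIdeal (w p) ^ n
        ⊔ Ideal.span {linearForm a - C (∑ i, a i * w p i)} = A ⊔ affineIdeal (w p) ^ n := by
      rw [hw1, hA, sup_right_comm]
    rw [hAeq] at hfin' hl₂
    refine ⟨hfin', ?_⟩
    rw [← hl₂ (max l₁ l₂) (le_max_right _ _), tjurinaAt, ← hl₁ (max l₁ l₂) (le_max_left _ _),
      projIdeal_smul (hc p)]
  have hfin'' := fun p => (hloc p).1
  rw [finrank_quotient_eq_sum (n := n) w hwinj ((Ideal.pow_le_pow_right (le_max_left _ _)).trans hn₁),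
    totalTjurina, finsum_eq_sum_of_support_subset (s := T), ← Finset.sum_coe_sort T (fun p => tjurinaAt f p)]
  · exact Finset.sum_congr rfl fun p _ => (hloc p).2
  · intro p hp
    rw [Finset.mem_coe, hmemT]
    by_contra h
    exact hp (tjurinaAt_eq_zero hf hd h)

/-! ### Graded Betti numbers -/

/-- Unlike `IsGradedMatrix.exists_lift`, this also covers generators of degree larger than that of
`v`, whose coefficients are forced to be `0`; the minimality arguments depend on this. -/
theorem exists_homogeneous_coeff {κ ι : Type*} [Fintype κ] {G : κ → ι → S} {a : κ → ℕ}
    (hG : ∀ i l, (G i l).IsHomogeneous (a i)) {v : ι → S} {e : ℕ}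
    (hv : ∀ l, (v l).IsHomogeneous e) (hmem : v ∈ Submodule.span S (Set.range G)) :
    ∃ q : κ → S, Fintype.linearCombination S G q = v ∧
      ∀ i, (a i ≤ e → (q i).IsHomogeneous (e - a i)) ∧ (e < a i → q i = 0) := by
  rw [span_range_eq_range_lc] at hmem
  obtain ⟨p, rfl⟩ := hmem
  refine ⟨fun i => if a i ≤ e then homogeneousComponent (e - a i) (p i) else 0, ?_, ?_⟩
  · ext1 l
    rw [← homogeneousComponent_eq_self (hv l), lc_apply, lc_apply, map_sum]
    refine Finset.sum_congr rfl fun i _ => ?_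
    split_ifs with h
    · rw [homogeneousComponent_mul_of_isHomogeneous (hG i l) h]
    · rw [zero_mul]
      symm
      ext m
      rw [coeff_homogeneousComponent, coeff_zero]
      split_ifs with hm
      · have hmul := (mem_pow_idealOfVars_iff' (a i) (p i * G i l)).mp
          (Ideal.mul_mem_left _ _ (form_le_pow_idealOfVars le_rfl (hG i l)))
        exact hmul m (by omega)
      · rfl
  · intro i
    constructor
    · intro h
      simp only [if_pos h]
      exact homogeneousComponent_isHomogeneous _ _
    · intro h
      exact if_neg (by omega)

namespace MinimalResolution

variable {f : S} {d n : ℕ} {δ : Fin (n + 2) → ℕ} {ε : Fin n → ℤ}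

/-- This is how minimality is used: no relation among the generators has a coefficient with nonzero
constant term, so no generator is a combination of the others. -/
theorem constantCoeff_eq_zero (R : MinimalResolution f d δ ε) {p : Fin (n + 2) → S}
    (hp : Fintype.linearCombination S R.gen p = 0) (i : Fin (n + 2)) :
    constantCoeff (p i) = 0 := by
  have h1 : p ∈ Submodule.span S (Set.range R.rel) := by
    rw [R.exact_rel]
    exact hp
  rw [span_range_eq_range_lc] at h1
  obtain ⟨q, rfl⟩ := h1
  rw [lc_apply, map_sum]
  exact Finset.sum_eq_zero fun j _ => by rw [map_mul, R.minimal, mul_zero]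

theorem constantCoeff_eq_one (R : MinimalResolution f d δ ε) {i : Fin (n + 2)} {p : Fin (n + 2) → S}
    (h : Fintype.linearCombination S R.gen p = R.gen i) : constantCoeff (p i) = 1 := by
  have h1 := R.constantCoeff_eq_zero (p := p - Pi.single i 1) (by
    rw [map_sub, h, Fintype.linearCombination_apply_single, one_smul, sub_self]) i
  rw [Pi.sub_apply, Pi.single_eq_same, map_sub, map_one] at h1
  exact sub_eq_zero.mp h1

theorem gen_zero_ne_zero (R : MinimalResolution f d δ ε) : R.gen 0 ≠ 0 := by
  intro h
  have := R.constantCoeff_eq_one (i := 0) (p := 0) (by rw [map_zero, h])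
  simp at this

theorem gen_mem_ker (R : MinimalResolution f d δ ε) (i : Fin (n + 2)) :
    R.gen i ∈ LinearMap.ker (Fintype.linearCombination S fun k => pderiv k f) := by
  have : R.gen i ∈ LinearMap.ker (gradientMap f) := by
    rw [← R.exact_gen]
    exact Submodule.subset_span ⟨i, rfl⟩
  exact this

theorem isGradedMatrix_gen (R : MinimalResolution f d δ ε) (D : ℕ) :
    IsGradedMatrix R.gen (fun i => D + δ i) (fun _ => D) :=
  fun i l _ => ⟨δ i, R.gen_homogeneous i l, add_comm _ _⟩

theorem exists_degree (R : MinimalResolution f d δ ε) (hd : 1 ≤ d) : ∃ γ : Fin n → ℕ,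
    (∀ j, (γ j : ℤ) = d + δ (j.addNat 2) - 1 + ε j) ∧
    IsGradedMatrix R.rel γ (fun i => d - 1 + δ i) := by
  -- Linear independence makes each row of `rel` nonzero; a nonzero entry has natural degree `e`,
  -- which bounds `cⱼ` from below.
  have hnn : ∀ j, 0 ≤ (d + δ (j.addNat 2) - 1 + ε j : ℤ) := by
    intro j
    obtain ⟨i, hi⟩ := Function.ne_iff.mp (R.injective_rel.ne_zero j)
    obtain ⟨e, -, he⟩ := R.rel_homogeneous j i hi
    omega
  refine ⟨fun j => (d + δ (j.addNat 2) - 1 + ε j : ℤ).toNat,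
    fun j => Int.toNat_of_nonneg (hnn j), fun j i hi => ?_⟩
  obtain ⟨e, he, heq⟩ := R.rel_homogeneous j i hi
  refine ⟨e, he, ?_⟩
  have := Int.toNat_of_nonneg (hnn j)
  dsimp only
  omega

theorem exists_finrank_syzygies (R : MinimalResolution f d δ ε) (hd : 1 ≤ d) : ∃ k₀, ∀ k : ℕ, k₀ ≤ k →
    2 * (finrank ℂ (submodulePiece (LinearMap.ker
      (Fintype.linearCombination S fun k => pderiv k f)) (fun _ => d - 1) k) : ℚ)
      = ((k : ℚ) - d - δ 0 + 2) * (k - d - δ 0 + 3) + (k - d - δ 1 + 2) * (k - d - δ 1 + 3)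
        + (2 * k - 2 * d + 5) * ∑ j, (ε j : ℚ) - 2 * ∑ j, (ε j : ℚ) * δ (j.addNat 2)
        - ∑ j, (ε j : ℚ) ^ 2 := by
  obtain ⟨γ, hγ, hrel⟩ := R.exists_degree hd
  refine ⟨∑ i, (d - 1 + δ i) + ∑ j, γ j, fun k hk => ?_⟩
  have hα : ∀ i, d - 1 + δ i ≤ k := fun i =>
    (Finset.single_le_sum (f := fun i => d - 1 + δ i) (fun _ _ => Nat.zero_le _)
      (Finset.mem_univ i)).trans ((Nat.le_add_right _ _).trans hk)
  have hγk : ∀ j, γ j ≤ k := fun j =>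
    (Finset.single_le_sum (f := γ) (fun _ _ => Nat.zero_le _)
      (Finset.mem_univ j)).trans ((Nat.le_add_left _ _).trans hk)
  have h1 := finrank_span_of_resolution (R.isGradedMatrix_gen (d - 1)) hrel R.exact_rel
    R.injective_rel hα hγk
  rw [R.exact_gen] at h1
  change finrank ℂ (submodulePiece (LinearMap.ker
      (Fintype.linearCombination S fun k => pderiv k f)) (fun _ => d - 1) k) + _ = _ at h1
  rw [Fin.sum_univ_succ, Fin.sum_univ_succ] at h1
  have hd1 : ((d - 1 : ℕ) : ℚ) = d - 1 := by push_cast [hd]; ring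
  have h2 : (finrank ℂ (submodulePiece (LinearMap.ker
      (Fintype.linearCombination S fun k => pderiv k f)) (fun _ => d - 1) k) : ℚ)
      + ∑ j, (formDim (k - γ j) : ℚ) = formDim (k - (d - 1 + δ 0))
      + (formDim (k - (d - 1 + δ 1)) + ∑ j : Fin n, (formDim (k - (d - 1 + δ (j.addNat 2))) : ℚ)) := by
    exact_mod_cast h1
  have e0 := two_mul_formDim_sub (hα 0)
  have e1 := two_mul_formDim_sub (hα 1)
  -- Pairing the generator of degree `d_{j+2}` with the `j`-th relation cancels the terms quadratic
  -- in `k`.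
  have e2 : ∀ j : Fin n, 2 * (formDim (k - (d - 1 + δ (j.addNat 2))) : ℚ)
      - 2 * (formDim (k - γ j) : ℚ)
      = (2 * k - 2 * d + 5) * (ε j : ℚ) - 2 * ((ε j : ℚ) * δ (j.addNat 2)) - (ε j : ℚ) ^ 2 := by
    intro j
    rw [two_mul_formDim_sub (hα _), two_mul_formDim_sub (hγk j)]
    have h3 : (γ j : ℚ) = d + δ (j.addNat 2) - 1 + ε j := by exact_mod_cast hγ j
    rw [h3]
    push_cast [hd1]
    ring
  have e3 := Finset.sum_congr (rfl : (Finset.univ : Finset (Fin n)) = Finset.univ)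
    (fun j _ => e2 j)
  simp only [Finset.sum_sub_distrib, ← Finset.mul_sum] at e3
  push_cast [hd1] at e0 e1
  linear_combination 2 * h2 + e0 + e1 + e3

/-- The term linear in `k` is kept, since `t = ∑ εⱼ` is not known yet; boundedness of the Hilbert
function removes it later. -/
theorem exists_hilb_formula (R : MinimalResolution f d δ ε) (hd : 1 ≤ d)
    (hf : f.IsHomogeneous d) : ∃ k₀, ∀ k : ℕ, k₀ ≤ k →
    (hilb (jacobianIdeal f) k : ℚ)
      = bettiE d δ ε + (d - 1) * (d - δ 0 - 1)
        + (k - d + 5 / 2) * (∑ j, (ε j : ℚ) - curveType d δ) := by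
  obtain ⟨k₀, hk₀⟩ := R.exists_finrank_syzygies hd
  refine ⟨max k₀ (d - 1), fun k hk => ?_⟩
  have hdk : d - 1 ≤ k := (le_max_right _ _).trans hk
  have h1 := hk₀ k ((le_max_left _ _).trans hk)
  have h2 := hilb_span_add (F := fun j => pderiv j f) (fun j => hf.pderiv) hdk
  rw [Fintype.card_fin] at h2
  have h3 : (hilb (jacobianIdeal f) k : ℚ) + 3 * formDim (k - (d - 1)) = formDim k
      + finrank ℂ (submodulePiece (LinearMap.ker
        (Fintype.linearCombination S fun k => pderiv k f)) (fun _ => d - 1) k) := by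
    exact_mod_cast h2
  have e0 := two_mul_formDim k
  have e1 := two_mul_formDim_sub hdk
  have hd1 : ((d - 1 : ℕ) : ℚ) = d - 1 := by push_cast [hd]; ring
  rw [hd1] at e1
  rw [bettiE, curveType]
  push_cast
  linear_combination h3 + h1 / 2 + e0 / 2 - 3 / 2 * e1

/-- If the syzygies of the partial derivatives are generated by the first generator and two
syzygies of degree `d - 1`, then there are at most three generators, and all but the first have
degree `d - 1`. -/
theorem degrees_of_ker_le_span (R : MinimalResolution f d δ ε) {D : ℕ} {K₁ K₂ : Fin 3 → S}
    (h1 : ∀ l, (K₁ l).IsHomogeneous D) (h2 : ∀ l, (K₂ l).IsHomogeneous D)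
    (hle : Submodule.span S (Set.range ![R.gen 0, K₁, K₂])
      ≤ LinearMap.ker (Fintype.linearCombination S fun k => pderiv k f))
    (hge : LinearMap.ker (Fintype.linearCombination S fun k => pderiv k f)
      ≤ Submodule.span S (Set.range ![R.gen 0, K₁, K₂])) :
    n ≤ 1 ∧ ∀ i, i ≠ 0 → δ i = D := by
  have hgen : LinearMap.ker (Fintype.linearCombination S fun k => pderiv k f)
      = Submodule.span S (Set.range R.gen) := R.exact_gen.symm
  have hW : ∀ i l, (![R.gen 0, K₁, K₂] i l).IsHomogeneous (![δ 0, D, D] i) := by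
    intro i l
    fin_cases i
    · exact R.gen_homogeneous 0 l
    · exact h1 l
    · exact h2 l
  have hK₁ : K₁ ∈ Submodule.span S (Set.range R.gen) :=
    hgen ▸ hle (Submodule.subset_span ⟨1, rfl⟩)
  have hK₂ : K₂ ∈ Submodule.span S (Set.range R.gen) :=
    hgen ▸ hle (Submodule.subset_span ⟨2, rfl⟩)
  obtain ⟨q₁, hq₁, hq₁'⟩ := exists_homogeneous_coeff R.gen_homogeneous h1 hK₁
  obtain ⟨q₂, hq₂, hq₂'⟩ := exists_homogeneous_coeff R.gen_homogeneous h2 hK₂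
  have hlc0 : ∀ i p, Fintype.linearCombination S R.gen (Pi.single i p) = p • R.gen i :=
    fun i p => Fintype.linearCombination_apply_single _ _ _ _
  have hexp : ∀ i, ∃ p : Fin 3 → S, p 0 • R.gen 0 + p 1 • K₁ + p 2 • K₂ = R.gen i ∧
      (δ i < D → p 1 = 0 ∧ p 2 = 0) ∧
      (δ i = D → (p 1).IsHomogeneous 0 ∧ (p 2).IsHomogeneous 0) := by
    intro i
    obtain ⟨p, hp, hp'⟩ := exists_homogeneous_coeff hW (R.gen_homogeneous i) (hge (R.gen_mem_ker i))
    rw [lc_three] at hp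
    refine ⟨p, hp, fun h => ⟨(hp' 1).2 h, (hp' 2).2 h⟩, fun h => ⟨?_, ?_⟩⟩
    · have := (hp' 1).1 h.ge
      simpa [h] using this
    · have := (hp' 2).1 h.ge
      simpa [h] using this
  -- In degree below `D` the generator would be a multiple of the first one. In degree above `D` it
  -- does not occur in `K₁` and `K₂`, so it would be a combination of the other generators.
  have hdeg : ∀ i, i ≠ 0 → δ i = D := by
    intro i hi
    obtain ⟨p, hp, hlt, -⟩ := hexp i
    rcases lt_trichotomy (δ i) D with h | h | h
    · exfalso
      obtain ⟨hp1, hp2⟩ := hlt h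
      rw [hp1, hp2, zero_smul, zero_smul, add_zero, add_zero, ← hlc0] at hp
      have := R.constantCoeff_eq_one hp
      simp [hi] at this
    · exact h
    · exfalso
      rw [← hq₁, ← hq₂, ← hlc0, ← map_smul, ← map_smul, ← map_add, ← map_add] at hp
      have := R.constantCoeff_eq_one hp
      simp [hi, (hq₁' i).2 h, (hq₂' i).2 h] at this
  refine ⟨?_, hdeg⟩
  by_contra! hn
  let e : Fin 3 → Fin (n + 2) := fun j => ⟨j + 1, by omega⟩
  have he0 : ∀ j, e j ≠ 0 := fun j h => by simpa [e] using congrArg Fin.val h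
  have he : Function.Injective e := fun j j' h => by
    have := congrArg Fin.val h
    simp only [e] at this
    exact Fin.ext (by omega)
  choose p hp _ hp0 using fun j => hexp (e j)
  have hconst : ∀ {s : S}, s.IsHomogeneous 0 → s = C (coeff 0 s) := by
    intro s hs
    rw [← homogeneousComponent_zero, homogeneousComponent_eq_self hs]
  -- Three generators of degree `D` have constant coefficients along `K₁, K₂`. A kernel vector of
  -- this `2 × 3` matrix combines them into a multiple of the first generator, a relation with
  -- constant coefficients that minimality forbids.
  let L : (Fin 3 → ℂ) →ₗ[ℂ] (Fin 2 → ℂ) :=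
    Matrix.mulVecLin (Matrix.of ![fun j => coeff 0 (p j 1), fun j => coeff 0 (p j 2)])
  obtain ⟨c, hcL, hc0⟩ := Submodule.exists_mem_ne_zero_of_ne_bot
    (LinearMap.ker_ne_bot_of_finrank_lt (f := L) (by simp))
  have hc1 : ∑ j, C (c j) * p j 1 = 0 := by
    have : ∑ j, coeff 0 (p j 1) * c j = 0 := congrFun (LinearMap.mem_ker.mp hcL) 0
    rw [← map_zero C, ← this, map_sum]
    refine Finset.sum_congr rfl fun j _ => ?_
    rw [C_mul, ← hconst (hp0 j (hdeg _ (he0 j))).1, mul_comm]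
  have hc2 : ∑ j, C (c j) * p j 2 = 0 := by
    have : ∑ j, coeff 0 (p j 2) * c j = 0 := congrFun (LinearMap.mem_ker.mp hcL) 1
    rw [← map_zero C, ← this, map_sum]
    refine Finset.sum_congr rfl fun j _ => ?_
    rw [C_mul, ← hconst (hp0 j (hdeg _ (he0 j))).2, mul_comm]
  have hrel : Fintype.linearCombination S R.gen
      (∑ j, Pi.single (e j) (C (c j)) - Pi.single 0 (∑ j, C (c j) * p j 0)) = 0 := by
    rw [map_sub, map_sum, hlc0]
    simp only [hlc0, ← hp, smul_add, smul_smul, Finset.sum_add_distrib, ← Finset.sum_smul, hc1, hc2]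
    simp
  apply hc0
  ext j
  have := R.constantCoeff_eq_zero hrel (e j)
  rw [Pi.sub_apply, Finset.sum_apply, Pi.single_eq_of_ne (he0 j), sub_zero,
    Finset.sum_eq_single j] at this
  · simpa using this
  · intro j' _ hj'
    exact Pi.single_eq_of_ne (he.ne hj'.symm) _
  · simp

end MinimalResolution

/-! ### Comparison of the minimal resolution with the Koszul submodule -/

/-- The total Tjurina number of a reduced curve in terms of the graded Betti numbers, and the
lower bound for it. -/
theorem totalTjurina_eq_and_bettiE_nonneg {f : S} {d : ℕ} (hd : 3 ≤ d) (hf : IsReducedCurve f d)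
    {n : ℕ} {δ : Fin (n + 2) → ℕ} {ε : Fin n → ℤ} (R : MinimalResolution f d δ ε) :
    (totalTjurina f : ℚ) = bettiE d δ ε + (d - 1) * (d - δ 0 - 1) ∧
    (curveType d δ : ℚ) = ∑ j, (ε j : ℚ) ∧ 0 ≤ bettiE d δ ε ∧
    (bettiE d δ ε = 0 → n ≤ 1 ∧ ∀ i, i ≠ 0 → δ i + 1 = d) := by
  obtain ⟨D, rfl⟩ : ∃ D, d = D + 1 := ⟨d - 1, by omega⟩
  obtain ⟨K₁, K₂, hK₁, hK₂, hle, hdim, hsat, hhilb⟩ := hasKoszulPair (D := D) (by omega)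
    (fun j => hf.homogeneous.pderiv) (hf.noCommonPrime (by omega)) (R.gen_homogeneous 0)
    (R.gen_mem_ker 0) R.gen_zero_ne_zero
  obtain ⟨k₀, hk₀⟩ := R.exists_hilb_formula (by omega) hf.homogeneous
  have hslope : (curveType (D + 1) δ : ℚ) = ∑ j, (ε j : ℚ) := by
    have h1 := hk₀ (max k₀ (2 * D)) (le_max_left _ _)
    have h2 := hk₀ (max k₀ (2 * D) + (D ^ 2 + 1)) ((le_max_left _ _).trans (Nat.le_add_right _ _))
    have b1 : hilb (jacobianIdeal f) (max k₀ (2 * D)) ≤ D ^ 2 := hhilb _ (le_max_right _ _)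
    have b2 : hilb (jacobianIdeal f) (max k₀ (2 * D) + (D ^ 2 + 1)) ≤ D ^ 2 :=
      hhilb _ ((le_max_right _ _).trans (Nat.le_add_right _ _))
    generalize hilb (jacobianIdeal f) (max k₀ (2 * D)) = a at h1 b1
    generalize hilb (jacobianIdeal f) (max k₀ (2 * D) + (D ^ 2 + 1)) = b at h2 b2
    -- Two values in `[0, D²]` taken `D² + 1` degrees apart differ by the integer slope times `D² +
    -- 1`, so the slope is zero.
    have h3 : (∑ j, ε j - curveType (D + 1) δ) * ((D : ℤ) ^ 2 + 1) = b - a := by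
      push_cast at h1 h2
      have : ((∑ j, (ε j : ℚ) - curveType (D + 1) δ) * ((D : ℚ) ^ 2 + 1)) = b - a := by
        linear_combination h1 - h2
      exact_mod_cast this
    have h4 : ∑ j, ε j - curveType (D + 1) δ = 0 := by
      have h5 : (b : ℤ) - a = 0 := by
        refine Int.eq_zero_of_abs_lt_dvd (Dvd.intro_left _ h3) ?_
        zify at b1 b2
        rw [abs_lt]
        constructor <;> linarith [Int.natCast_nonneg a, Int.natCast_nonneg b]
      rw [h5] at h3
      exact (mul_eq_zero.mp h3).resolve_right (by positivity)
    exact_mod_cast (sub_eq_zero.mp h4).symm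
  have hE : ∀ k, k₀ ≤ k → (hilb (jacobianIdeal f) k : ℚ)
      = bettiE (D + 1) δ ε + D * (D - δ 0) := by
    intro k hk
    rw [hk₀ k hk, hslope]
    push_cast
    ring
  obtain ⟨k₁, hk₁⟩ := exists_hilb_eq_totalTjurina hf.homogeneous (by omega) hhilb
  -- In large degrees `E` is the codimension of the Koszul submodule in the module of all syzygies;
  -- nonnegativity and the equality case both come from this.
  have hpiece : ∀ k, 2 * D + δ 0 ≤ k → k₀ ≤ k →
      (finrank ℂ (submodulePiece (LinearMap.ker
        (Fintype.linearCombination S fun k => pderiv k f)) (fun _ => D) k) : ℚ)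
      = finrank ℂ (submodulePiece (Submodule.span S (Set.range ![R.gen 0, K₁, K₂]))
        (fun _ => D) k) + bettiE (D + 1) δ ε := by
    intro k hk hk'
    have h1 := hilb_span_add (F := fun j => pderiv j f) (D := D)
      (fun j => hf.homogeneous.pderiv) (k := k) (by omega)
    have h2 := hdim k hk
    rw [Fintype.card_fin] at h1
    have h1' : (hilb (jacobianIdeal f) k : ℚ) + 3 * formDim (k - D) = formDim k
        + finrank ℂ (submodulePiece (LinearMap.ker
          (Fintype.linearCombination S fun k => pderiv k f)) (fun _ => D) k) := by
      exact_mod_cast h1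
    have h2' : (finrank ℂ (submodulePiece (Submodule.span S (Set.range ![R.gen 0, K₁, K₂]))
        (fun _ => D) k) : ℚ) + formDim (k - (2 * D + δ 0))
        = formDim (k - (D + δ 0)) + 2 * formDim (k - 2 * D) := by
      exact_mod_cast h2
    have h3 := hE k hk'
    have e0 := two_mul_formDim k
    have e1 := two_mul_formDim_sub (k := k) (a := D) (by omega)
    have e2 := two_mul_formDim_sub hk
    have e3 := two_mul_formDim_sub (k := k) (a := D + δ 0) (by omega)
    have e4 := two_mul_formDim_sub (k := k) (a := 2 * D) (by omega)
    push_cast at e2 e3 e4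
    linear_combination -h1' - h2' + h3 - e0 / 2 + 3 / 2 * e1 + e2 / 2 - e3 / 2 - e4
  have hpl : ∀ k, submodulePiece (Submodule.span S (Set.range ![R.gen 0, K₁, K₂])) (fun _ => D) k
      ≤ submodulePiece (LinearMap.ker
        (Fintype.linearCombination S fun k => pderiv k f)) (fun _ => D) k :=
    fun k => inf_le_inf_left _ hle
  have hfd : ∀ k, FiniteDimensional ℂ (submodulePiece (LinearMap.ker
        (Fintype.linearCombination S fun k => pderiv k f)) (fun _ => D) k) := fun k =>
    Submodule.finiteDimensional_of_le inf_le_left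
  refine ⟨?_, hslope, ?_, ?_⟩
  · rw [← hk₁ (max k₀ k₁) (le_max_right _ _), hE _ (le_max_left _ _)]
    push_cast
    ring
  · have h1 := hpiece (max k₀ (2 * D + δ 0)) (le_max_right _ _) (le_max_left _ _)
    have h2 : (finrank ℂ (submodulePiece (Submodule.span S (Set.range ![R.gen 0, K₁, K₂]))
        (fun _ => D) (max k₀ (2 * D + δ 0))) : ℚ) ≤ finrank ℂ (submodulePiece (LinearMap.ker
        (Fintype.linearCombination S fun k => pderiv k f)) (fun _ => D) (max k₀ (2 * D + δ 0))) := by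
      exact_mod_cast Submodule.finrank_mono (hpl _)
    linarith
  · intro h0
    have hker := hsat ⟨max k₀ (2 * D + δ 0), fun k hk => by
      have h1 := hpiece k ((le_max_right _ _).trans hk) ((le_max_left _ _).trans hk)
      rw [h0, add_zero] at h1
      exact (Submodule.eq_of_le_of_finrank_eq (hpl k) (by exact_mod_cast h1.symm)).ge⟩
    obtain ⟨hn, hdeg⟩ := R.degrees_of_ker_le_span hK₁ hK₂ hle hker
    exact ⟨hn, fun i hi => by rw [hdeg i hi]⟩

end PlaneCurve

end

/-! ### The theorem and the numerical example -/

theorem mainTheorem4 :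
    -- for every reduced curve of degree `d ≥ 3`, with `m = n + 2` exponents `d₁ ≤ … ≤ dₘ`:
    (∀ (d : ℕ) (f : PlaneCurve.S), 3 ≤ d → PlaneCurve.IsReducedCurve f d →
      ∀ (n : ℕ) (δ : Fin (n + 2) → ℕ) (ε : Fin n → ℤ),
        PlaneCurve.HasGradedBettiNumbers f d δ ε →
          (PlaneCurve.totalTjurina f : ℚ) - ((d : ℚ) - 1) * ((d : ℚ) - δ 0 - 1)
              = PlaneCurve.bettiE d δ ε ∧
          0 ≤ PlaneCurve.bettiE d δ ε ∧
          -- `E = 0` iff `m = 3` and `d₂ = d₃ = d - 1`, or the curve is free with `d₁ = 0`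
          (PlaneCurve.bettiE d δ ε = 0 ↔
            (n = 1 ∧ ∀ i : Fin (n + 2), 1 ≤ (i : ℕ) → δ i + 1 = d) ∨
            (n = 0 ∧ δ 0 = 0))) ∧
    -- the inequality does not follow from the previously known conditions
    (PlaneCurve.KnownConditions 10 (n := 2) ![3, 8, 8, 15] ![1, 1] ∧
      PlaneCurve.bettiE 10 (n := 2) ![3, 8, 8, 15] ![1, 1] = -1 ∧
      ¬ ∃ (d : ℕ) (f : PlaneCurve.S), 3 ≤ d ∧ PlaneCurve.IsReducedCurve f d ∧
        PlaneCurve.HasGradedBettiNumbers f d (n := 2) ![3, 8, 8, 15] ![1, 1]) := by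
  refine ⟨?_, ?_, ?_, ?_⟩
  · rintro d f hd hf n δ ε ⟨R⟩
    obtain ⟨hτ, ht, hE, h0⟩ := PlaneCurve.totalTjurina_eq_and_bettiE_nonneg hd hf R
    refine ⟨by rw [hτ]; ring, hE, fun h => ?_, ?_⟩
    · obtain ⟨hn, hδ⟩ := h0 h
      obtain rfl | rfl : n = 1 ∨ n = 0 := by omega
      · refine Or.inl ⟨rfl, fun i hi => hδ i ?_⟩
        rintro rfl
        exact absurd hi (by simp)
      -- For a free curve the empty sum gives `t = 0`, so `E` reduces to `d₁²`.
      · rw [Fin.sum_univ_zero] at ht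
        refine Or.inr ⟨rfl, ?_⟩
        rw [PlaneCurve.bettiE, ht] at h
        simpa using h
    · rintro (⟨rfl, hδ⟩ | ⟨rfl, hδ⟩)
      · have h1 : ((δ 1 : ℕ) : ℚ) + 1 = d := by exact_mod_cast hδ 1 (by simp)
        have h2 : ((δ 2 : ℕ) : ℚ) + 1 = d := by exact_mod_cast hδ 2 (by simp)
        -- From `d₂ = d - 1` one gets `t = d₁ = ε₁`, and then `E = d₁ (d₂ - d₃) = 0`.
        have h3 : (PlaneCurve.curveType d δ : ℚ) = δ 0 := by
          rw [PlaneCurve.curveType]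
          push_cast
          linear_combination h1
        rw [h3, Fin.sum_univ_one] at ht
        have h4 : (0 : Fin 1).addNat 2 = (2 : Fin 3) := rfl
        rw [PlaneCurve.bettiE, h3, Fin.sum_univ_one, Fin.sum_univ_one, ← ht, h4]
        linear_combination (δ 0 : ℚ) * (h1 - h2)
      · rw [Fin.sum_univ_zero] at ht
        rw [PlaneCurve.bettiE, ht, hδ]
        simp
  · refine ⟨by norm_num, by norm_num, by simp, ?_, ?_, ?_, ?_, ?_, ?_⟩
    · exact Fin.monotone_iff_le_succ.mpr (by decide)
    · decide
    · decide
    · exact Fin.monotone_iff_le_succ.mpr (by decide)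
    · decide
    · decide
  · norm_num [PlaneCurve.bettiE, PlaneCurve.curveType, Fin.sum_univ_two, Fin.addNat]
  · rintro ⟨d, f, hd, hf, ⟨R⟩⟩
    obtain ⟨-, ht, hE, -⟩ := PlaneCurve.totalTjurina_eq_and_bettiE_nonneg hd hf R
    -- The degree is not prescribed here: `t = ∑ εⱼ` reads `12 - d = 2`.
    have hd' : d = 10 := by
      have : (d : ℚ) = 10 := by
        simp [PlaneCurve.curveType] at ht
        linarith
      exact_mod_cast this
    subst hd'
    norm_num [PlaneCurve.bettiE, PlaneCurve.curveType, Fin.sum_univ_two, Fin.addNat] at hE
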